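/- **Setting.** Let $\Omega\subset\mathbb R^d$ be convex and compact with positive volume, $\Theta\subset\mathbb R^q$ compact, $\zeta:\Omega\to\mathbb R$ (the true process) measurable, and $y^s:\Omega\times\Theta\to\mathbb R$ (the computer code) measurable in $x$, and for every $x\in\Omega$ continuous in $\theta$ on $\Theta$ and differentiable in $\theta$ in the interior of $\Theta$. One observes $y^p_i=\zeta(x_i)+e_i$, $i=1,2,\dots$. Let $\hat y^s_n$ (the emulators) be possibly random functions on $\Omega\times\Theta$, differentiable in $\theta$ in the interior of $\Theta$, and let the OLS calibration estimator $\hat\theta^{OLS}_n$ be a random vector with $$\hat\theta^{OLS}_n\in\operatorname*{argmin}_{\theta\in\Theta}\sum_{i=1}^n\big(y^p_i-\hat y^s_n(x_i,\theta)\big)^2\quad\text{almost surely.}$$ **Assumptions.** - (A1) The $x_i$ are i.i.d. uniform on $\Omega$; the $e_i$ are i.i.d. with mean $0$ and variance $\sigma^2<\infty$; the sequences $\{x_i\}$ and $\{e_i\}$ are independent. - (A2) $\theta^*$ is the unique minimizer of $\theta\mapsto\|\zeta-y^s(\cdot,\theta)\|_{L_2(\Omega)}$ over $\Theta$, and is an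 interior point of $\Theta$. - (A3) $\sup_{\theta\in\Theta}\|y^s(\cdot,\theta)\|_{L_2(\Omega)}<\infty$. - (A4) $V:=E\big[\frac{\partial^2}{\partial\theta\,\partial\theta^{T}}(\zeta(x_1)-y^s(x_1,\theta^*))^2\big]$ is invertible. - (C1) $\sup_{\Omega\times\Theta}|\hat y^s_n-y^s|=o_p(n^{-1/2})$. - (C2) $\sup_{\Omega\times\operatorname{int}\Theta}\big|\frac{\partial\hat y^s_n}{\partial\theta_j}-\frac{\partial y^s}{\partial\theta_j}\big|=o_p(n^{-1/2})$ for $j=1,\dots,q$. - (Smoothness) There are an open neighborhood $U\subset\Theta$ of $\theta^*$ and a function $L\in L_2(\Omega)$ (for instance a constant) such that for every $x\in\Omega$ the function $y^s(x,\cdot)$ is $C^2$ on $U$ and its second derivative is Lipschitz on $U$ with constant $L(x)$. - (Finite $\Sigma_2$) $E\big\|\frac{\partial}{\partial\theta}(y^p_1-y^s(x_1,\theta^*))^2\big\|^2<\infty$. Put $$W=E\Big[\tfrac{\partial y^s}{\partial\theta}(x_1,\theta^*)\tfrac{\partial y^s}{\partial\theta^{T}}(x_1,\theta^*)\Big],\qquad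 B=E\Big[(\zeta(x_1)-y^s(x_1,\theta^*))^2\,\tfrac{\partial y^s}{\partial\theta}(x_1,\theta^*)\tfrac{\partial y^s}{\partial\theta^{T}}(x_1,\theta^*)\Big],$$ $$\Sigma_1=4\sigma^2W,\qquad \Sigma_2=E\big[s_1s_1^{T}\big],\qquad s_i=\tfrac{\partial}{\partial\theta}(y^p_i-y^s(x_i,\theta^*))^2 .$$ **Theorem 3.** Under these assumptions: 1. (Consistency) $\hat\theta^{OLS}_n\to\theta^*$ in probability. 2. (Expansion) $\displaystyle \hat\theta^{OLS}_n-\theta^*=-V^{-1}\Big\{\frac1n\sum_{i=1}^n\frac{\partial}{\partial\theta}\big(y^p_i-y^s(x_i,\theta^*)\big)^2\Big\}+o_p(n^{-1/2}).$ 3. (Asymptotic variance) $\sqrt n(\hat\theta^{OLS}_n-\theta^*)$ converges in distribution to $N(0,V^{-1}\Sigma_2V^{-1})$. 4. (Asymptotic variance of $L_2$ calibration) Every sequence of random vectors $T_n$ with the asymptotic expansion of the $L_2$ calibration estimator, $T_n-\theta^*=2V^{-1}\big\{\frac1n\sum_{i=1}^n e_i\frac{\partial y^s}{\partial\theta}(x_i,\theta^*)\big\}+o_p(n^{-1/2})$,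 satisfies $\sqrt n(T_n-\theta^*)\to N(0,V^{-1}\Sigma_1V^{-1})$ in distribution. 5. (Comparison) $\Sigma_2=\Sigma_1+4B$; the matrix $V^{-1}\Sigma_2V^{-1}-V^{-1}\Sigma_1V^{-1}$ is positive semidefinite; and it is zero if and only if $B=0$. It is zero if the computer model is perfect, i.e. $\zeta=y^s(\cdot,\theta^*)$ almost everywhere on $\Omega$. Conversely, if $\frac{\partial y^s}{\partial\theta}(x,\theta^*)\neq0$ for almost every $x\in\Omega$ and it is zero, then $\zeta=y^s(\cdot,\theta^*)$ almost everywhere on $\Omega$. -/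

import Mathlib

open MeasureTheory ProbabilityTheory Filter Topology
open scoped ENNReal

noncomputable section

namespace OLSCalibration

/-- The partial derivative `∂f/∂θ_j` at `θ`. -/
def partialDeriv {q : ℕ} (j : Fin q) (f : EuclideanSpace ℝ (Fin q) → ℝ)
    (θ : EuclideanSpace ℝ (Fin q)) : ℝ :=
  fderiv ℝ f θ (EuclideanSpace.single j 1)

/-- The Hessian matrix `∂²f/∂θ∂θᵀ` at `θ`. -/
def hessianMatrix {q : ℕ} (f : EuclideanSpace ℝ (Fin q) → ℝ)
    (θ : EuclideanSpace ℝ (Fin q)) : Matrix (Fin q) (Fin q) ℝ :=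
  Matrix.of fun j k => partialDeriv j (partialDeriv k f) θ

/-- The `L²(Ω)` distance (Lebesgue measure on `Ω`), with values in `[0, ∞]`. -/
def l2Dist {d : ℕ} (Ω : Set (EuclideanSpace ℝ (Fin d)))
    (f g : EuclideanSpace ℝ (Fin d) → ℝ) : ℝ≥0∞ :=
  eLpNorm (fun z => f z - g z) 2 (volume.restrict Ω)

/-- `θstar` is the unique minimizer over `Θ` of `θ ↦ ‖ζ - yˢ(·, θ)‖` in `L²(Ω)`. -/
def IsUniqueL2Projection {d q : ℕ} (Ω : Set (EuclideanSpace ℝ (Fin d)))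
    (Θ : Set (EuclideanSpace ℝ (Fin q))) (ζ : EuclideanSpace ℝ (Fin d) → ℝ)
    (ys : EuclideanSpace ℝ (Fin d) → EuclideanSpace ℝ (Fin q) → ℝ)
    (θstar : EuclideanSpace ℝ (Fin q)) : Prop :=
  θstar ∈ Θ ∧ ∀ θ ∈ Θ, θ ≠ θstar →
    l2Dist Ω ζ (fun z => ys z θstar) < l2Dist Ω ζ (fun z => ys z θ)

/-- The physical response `yᵖ_i = ζ(x_i) + e_i`. -/
def response {S : Type*} {d : ℕ} (ζ : EuclideanSpace ℝ (Fin d) → ℝ)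
    (x : ℕ → S → EuclideanSpace ℝ (Fin d)) (e : ℕ → S → ℝ) (i : ℕ) (ω : S) : ℝ :=
  ζ (x i ω) + e i ω

/-- `θhat` minimizes `∑_{i < n} (y_i - g(x_i, θ))²` over `θ ∈ Θ`. -/
def IsLeastSquares {d q : ℕ} (Θ : Set (EuclideanSpace ℝ (Fin q))) (n : ℕ)
    (x : ℕ → EuclideanSpace ℝ (Fin d)) (y : ℕ → ℝ)
    (g : EuclideanSpace ℝ (Fin d) → EuclideanSpace ℝ (Fin q) → ℝ)
    (θhat : EuclideanSpace ℝ (Fin q)) : Prop :=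
  θhat ∈ Θ ∧ ∀ θ ∈ Θ,
    ∑ i ∈ Finset.range n, (y i - g (x i) θhat) ^ 2 ≤ ∑ i ∈ Finset.range n, (y i - g (x i) θ) ^ 2

/-- `Z_n = o_p(n^{-1/2})` for nonnegative `Z_n`: `P(√n Z_n ≥ ε) → 0` for every `ε > 0`
(outer probability where `Z_n` is not measurable). -/
def IsLittleOpInvSqrt {S : Type*} [MeasurableSpace S] (P : Measure S) (Z : ℕ → S → ℝ≥0∞) : Prop :=
  ∀ ε : ℝ, 0 < ε →
    Tendsto (fun n : ℕ => P {ω | ENNReal.ofReal ε ≤ ENNReal.ofReal (√(n : ℝ)) * Z n ω})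
      atTop (𝓝 0)

/-- The vector `∂/∂θ (yᵖ_i - yˢ(x_i, θ))²` at `θ`. -/
def score {S : Type*} {d q : ℕ} (ζ : EuclideanSpace ℝ (Fin d) → ℝ)
    (ys : EuclideanSpace ℝ (Fin d) → EuclideanSpace ℝ (Fin q) → ℝ)
    (x : ℕ → S → EuclideanSpace ℝ (Fin d)) (e : ℕ → S → ℝ)
    (θ : EuclideanSpace ℝ (Fin q)) (i : ℕ) (ω : S) : EuclideanSpace ℝ (Fin q) :=
  gradient (fun t => (response ζ x e i ω - ys (x i ω) t) ^ 2) θ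

/-- `V = E[∂²/∂θ∂θᵀ (ζ(x) - yˢ(x, θ))²]` with `x` uniform on `Ω`. -/
def matV {d q : ℕ} (Ω : Set (EuclideanSpace ℝ (Fin d))) (ζ : EuclideanSpace ℝ (Fin d) → ℝ)
    (ys : EuclideanSpace ℝ (Fin d) → EuclideanSpace ℝ (Fin q) → ℝ)
    (θ : EuclideanSpace ℝ (Fin q)) : Matrix (Fin q) (Fin q) ℝ :=
  Matrix.of fun j k =>
    ∫ z, hessianMatrix (fun t => (ζ z - ys z t) ^ 2) θ j k ∂(ProbabilityTheory.cond volume Ω)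

/-- `W = E[(∂yˢ/∂θ)(x, θ) (∂yˢ/∂θᵀ)(x, θ)]` with `x` uniform on `Ω`. -/
def matW {d q : ℕ} (Ω : Set (EuclideanSpace ℝ (Fin d)))
    (ys : EuclideanSpace ℝ (Fin d) → EuclideanSpace ℝ (Fin q) → ℝ)
    (θ : EuclideanSpace ℝ (Fin q)) : Matrix (Fin q) (Fin q) ℝ :=
  Matrix.of fun j k =>
    ∫ z, gradient (ys z) θ j * gradient (ys z) θ k ∂(ProbabilityTheory.cond volume Ω)

/-- `B = E[(ζ(x) - yˢ(x, θ))² (∂yˢ/∂θ)(x, θ) (∂yˢ/∂θᵀ)(x, θ)]` with `x` uniform on `Ω`. -/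
def matB {d q : ℕ} (Ω : Set (EuclideanSpace ℝ (Fin d))) (ζ : EuclideanSpace ℝ (Fin d) → ℝ)
    (ys : EuclideanSpace ℝ (Fin d) → EuclideanSpace ℝ (Fin q) → ℝ)
    (θ : EuclideanSpace ℝ (Fin q)) : Matrix (Fin q) (Fin q) ℝ :=
  Matrix.of fun j k =>
    ∫ z, (ζ z - ys z θ) ^ 2 * (gradient (ys z) θ j * gradient (ys z) θ k)
      ∂(ProbabilityTheory.cond volume Ω)

/-- `Σ₁ = 4 σ² W` with `σ² = E e²`. -/
def matSigma1 {S : Type*} [MeasurableSpace S] (P : Measure S) {d q : ℕ}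
    (Ω : Set (EuclideanSpace ℝ (Fin d)))
    (ys : EuclideanSpace ℝ (Fin d) → EuclideanSpace ℝ (Fin q) → ℝ)
    (e : ℕ → S → ℝ) (θ : EuclideanSpace ℝ (Fin q)) : Matrix (Fin q) (Fin q) ℝ :=
  (4 * ∫ ω, e 0 ω ^ 2 ∂P) • matW Ω ys θ

/-- `Σ₂ = E[s sᵀ]` with `s = ∂/∂θ (yᵖ - yˢ(x, θ))²`. -/
def matSigma2 {S : Type*} [MeasurableSpace S] (P : Measure S) {d q : ℕ}
    (ζ : EuclideanSpace ℝ (Fin d) → ℝ)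
    (ys : EuclideanSpace ℝ (Fin d) → EuclideanSpace ℝ (Fin q) → ℝ)
    (x : ℕ → S → EuclideanSpace ℝ (Fin d)) (e : ℕ → S → ℝ)
    (θ : EuclideanSpace ℝ (Fin q)) : Matrix (Fin q) (Fin q) ℝ :=
  Matrix.of fun j k => ∫ ω, score ζ ys x e θ 0 ω j * score ζ ys x e θ 0 ω k ∂P

/-- The estimators `T_n` of `θ` are asymptotically normal with covariance matrix `C`:
`√n (T_n - θ)` converges in distribution to `N(0, C)`, `C` being positive semidefinite. -/
def HasAsymptoticCovariance {S : Type*} [MeasurableSpace S] (P : Measure S)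
    [IsProbabilityMeasure P] {q : ℕ} (T : ℕ → S → EuclideanSpace ℝ (Fin q))
    (θ : EuclideanSpace ℝ (Fin q)) (C : Matrix (Fin q) (Fin q) ℝ) : Prop :=
  C.PosSemidef ∧
    TendstoInDistribution (fun (n : ℕ) ω => √(n : ℝ) • (T n ω - θ)) atTop
      (id : EuclideanSpace ℝ (Fin q) → EuclideanSpace ℝ (Fin q)) (fun _ => P)
      (multivariateGaussian 0 C)

end OLSCalibration

end

/-!
The sample consists of the pairs `(x i, e i)`, which are i.i.d. with law `μ.prod ν`, where `μ` is
the uniform distribution on `Ω` and `ν` the law of the errors (`isSample_prodMk`). Statements of the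
form `o_p` are treated as limits along the filter `probFilter` on `ℕ × S`, whose sets have sections
of probability tending to one; products and sums of `o_p` terms are then handled by the usual
calculus of limits, and what holds with probability tending to one by `filter_upwards`.

*Consistency* (`tendsto_leastSquares`). The mean of the squared residual over the sample is compared
with its expectation, which is minimal at `θstar` only. As no envelope for `ys` is assumed, there is
no uniform law of large numbers; Wald's argument (`exists_ball_integral_lt`) replaces it: away from
`θstar` the parameter set is covered by finitely many balls on which the infimum of the squared
residual has an expectation above the minimum, and the law of large numbers is applied to these
infima. The error `δ` of the emulator costs a factor `1 + δ` and a term `δ + δ ^ 2`.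

*Expansion* (`tendsto_expansion`). With probability tending to one the estimator is an interior
point, so that it solves the score equation of the emulator (`IsLeastSquares.empMean_eq_zero`).
Replacing the emulator by the code costs `o_p(n^{-1/2})`, and a Taylor expansion at `θstar`
(`abs_score_sub_le`) has a remainder quadratic in `θhat - θstar`, with a factor whose sample mean
converges. Hence `sbar + V (θhat - θstar)` is `o_p(1) ‖θhat - θstar‖ + o_p(n^{-1/2})`, where `sbar`
is the mean score; as `√n sbar` is bounded in probability, this can be solved for `θhat - θstar`. The
derivatives of the code at `θstar` are not assumed to be square integrable: this follows from the
square integrability of the code near `θstar`, since they are approximated in `L²` by difference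
quotients (`memLp_fderiv`, `memLp_fderiv_fderiv`). The mean score vanishes by the first-order
condition of the `L²` projection (`integral_mul_fderiv_eq_zero`).

*Asymptotic distributions* (`IsSample.hasAsymptoticCovariance_toEuclideanLin`). They follow from the
expansions by Slutsky's theorem and the multivariate central limit theorem
(`IsSample.tendstoInDistribution`), which reduces to the one-dimensional one by way of
characteristic functions.

*Comparison* (`comparison`). The score is `-2 (R + e) D` with the residual
`R = ζ - ys(·, θstar)`, the gradient `D` of the code, and an independent centered error `e`, so that
the mixed terms of its second moments vanish and `Σ₂ = Σ₁ + 4 B` (`integral_scoreFun_mul`). Here `B`,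
the second moment matrix of `R D`, is positive semidefinite, and zero only if `R D = 0` almost
everywhere.

Without parameters, `q = 0`, the residual need not be square integrable; every claim is then trivial
and this case is treated apart.
-/

noncomputable section

namespace OLSCalibration

/-! ### Convergence in probability as convergence along a filter -/

/-- The filter on `ℕ × S` of the sets whose sections at `n` have `P`-probability tending to one.
A sequence of functions on `S`, seen as a function on `ℕ × S`, converges along this filter if and
only if it converges in (outer) probability, so that the calculus of `o_p` is that of limits. -/
def probFilter {S : Type*} [MeasurableSpace S] (P : Measure S) : Filter (ℕ × S) where
  sets := {A | Tendsto (fun n => P {ω | (n, ω) ∉ A}) atTop (𝓝 0)}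
  univ_sets := by simp
  sets_of_superset := fun {A B} hA hAB => by
    refine tendsto_of_tendsto_of_tendsto_of_le_of_le tendsto_const_nhds hA (fun _ => zero_le)
      fun n => measure_mono fun ω hω h => hω (hAB h)
  inter_sets := fun {A B} hA hB => by
    refine tendsto_of_tendsto_of_tendsto_of_le_of_le tendsto_const_nhds
      (by simpa using Tendsto.add hA hB) (fun _ => zero_le) fun n => ?_
    refine (measure_mono ?_).trans (measure_union_le _ _)
    intro ω hω
    by_contra h
    simp only [Set.mem_union, Set.mem_ofPred_eq, not_or, not_not] at h
    exact hω h

section ProbFilter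

variable {S : Type*} [MeasurableSpace S] {P : Measure S}

lemma eventually_probFilter {Q : ℕ × S → Prop} :
    (∀ᶠ p in probFilter P, Q p) ↔ Tendsto (fun n => P {ω | ¬ Q (n, ω)}) atTop (𝓝 0) :=
  Iff.rfl

lemma eventually_probFilter_of_ae {Q : ℕ × S → Prop} (h : ∀ᵐ ω ∂P, ∀ n, Q (n, ω)) :
    ∀ᶠ p in probFilter P, Q p := by
  rw [eventually_probFilter]
  have : ∀ n, P {ω | ¬ Q (n, ω)} = 0 := fun n => by
    have := h.mono fun ω hω => hω n
    exact this
  simp [this]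

lemma tendsto_fst_probFilter : Tendsto Prod.fst (probFilter P) atTop := by
  rw [tendsto_atTop]
  intro N
  rw [eventually_probFilter]
  refine tendsto_const_nhds.congr' ?_
  filter_upwards [eventually_ge_atTop N] with n hn
  simp [hn]

lemma isLittleOpInvSqrt_iff {Z : ℕ → S → ℝ≥0∞} :
    IsLittleOpInvSqrt P Z ↔
      Tendsto (fun p : ℕ × S => ENNReal.ofReal (√(p.1 : ℝ)) * Z p.1 p.2) (probFilter P) (𝓝 0) := by
  rw [ENNReal.tendsto_nhds_zero]
  constructor
  · intro h ε hε
    obtain ⟨δ, hδ, hδε⟩ : ∃ δ : ℝ, 0 < δ ∧ ENNReal.ofReal δ ≤ ε := by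
      rcases eq_or_ne ε ∞ with rfl | hε'
      · exact ⟨1, one_pos, le_top⟩
      · exact ⟨ε.toReal, ENNReal.toReal_pos hε.ne' hε', by simp [hε']⟩
    rw [eventually_probFilter]
    refine tendsto_of_tendsto_of_tendsto_of_le_of_le tendsto_const_nhds (h δ hδ)
      (fun _ => zero_le) fun n => measure_mono fun ω hω => ?_
    exact hδε.trans (not_le.1 hω).le
  · intro h ε hε
    have := h (ENNReal.ofReal (ε / 2)) (by simpa using hε)
    rw [eventually_probFilter] at this
    refine tendsto_of_tendsto_of_tendsto_of_le_of_le tendsto_const_nhds this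
      (fun _ => zero_le) fun n => measure_mono fun ω hω => ?_
    refine not_le.2 (lt_of_lt_of_le ?_ hω)
    exact (ENNReal.ofReal_lt_ofReal_iff hε).2 (half_lt_self hε)

lemma tendstoInMeasure_const_iff {E : Type*} [PseudoEMetricSpace E] {f : ℕ → S → E} {c : E} :
    TendstoInMeasure P f atTop (fun _ => c) ↔
      Tendsto (fun p : ℕ × S => f p.1 p.2) (probFilter P) (𝓝 c) := by
  rw [EMetric.tendsto_nhds]
  simp only [eventually_probFilter, not_lt, gt_iff_lt]
  rfl

/-- Almost sure convergence implies convergence in probability. -/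
lemma tendsto_probFilter_of_ae [IsFiniteMeasure P] {E : Type*} [PseudoEMetricSpace E]
    {f : ℕ → S → E} {c : E} (hf : ∀ n, AEStronglyMeasurable (f n) P)
    (h : ∀ᵐ ω ∂P, Tendsto (fun n => f n ω) atTop (𝓝 c)) :
    Tendsto (fun p : ℕ × S => f p.1 p.2) (probFilter P) (𝓝 c) :=
  tendstoInMeasure_const_iff.1 (tendstoInMeasure_of_tendsto_ae hf h)

/-- A sequence that converges in distribution is bounded in probability. -/
lemma exists_eventually_measure_norm_ge_lt [IsProbabilityMeasure P] {E : Type*}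
    [NormedAddCommGroup E] [MeasurableSpace E] [BorelSpace E]
    {S' : Type*} [MeasurableSpace S'] {P' : Measure S'} [IsProbabilityMeasure P']
    {X : ℕ → S → E} {Y : S' → E}
    (h : TendstoInDistribution X atTop Y (fun _ => P) P') {η : ℝ≥0∞} (hη : 0 < η) :
    ∃ K : ℝ, 0 < K ∧ ∀ᶠ n in atTop, P {ω | K ≤ ‖X n ω‖} < η := by
  have hY := h.aemeasurable_limit
  have h1 : Tendsto (fun k : ℕ => P'.map Y {v | (k : ℝ) + 1 ≤ ‖v‖}) atTop (𝓝 0) := by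
    have : IsProbabilityMeasure (P'.map Y) := Measure.isProbabilityMeasure_map hY
    have h2 := tendsto_measure_iInter_atTop (μ := P'.map Y)
      (s := fun k : ℕ => {v : E | (k : ℝ) + 1 ≤ ‖v‖})
      (fun k => (measurableSet_le measurable_const measurable_norm).nullMeasurableSet)
      (fun k l hkl v hv => by
        have : (k : ℝ) ≤ l := by exact_mod_cast hkl
        simp only [Set.mem_ofPred_eq] at hv ⊢
        linarith) ⟨0, measure_ne_top _ _⟩
    have h3 : ⋂ k : ℕ, {v : E | (k : ℝ) + 1 ≤ ‖v‖} = ∅ := by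
      ext v
      simp only [Set.mem_iInter, Set.mem_ofPred_eq, Set.mem_empty_iff_false, iff_false, not_forall,
        not_le]
      obtain ⟨k, hk⟩ := exists_nat_gt ‖v‖
      exact ⟨k, by linarith⟩
    simpa [h3, Function.comp_def] using h2
  obtain ⟨k, hk⟩ := (h1.eventually_lt_const hη).exists
  refine ⟨(k : ℝ) + 1, by positivity, ?_⟩
  have h4 := ProbabilityMeasure.limsup_measure_closed_le_of_tendsto h.tendsto
    (F := {v : E | (k : ℝ) + 1 ≤ ‖v‖}) (isClosed_le continuous_const continuous_norm)
  have h5 := eventually_lt_of_limsup_lt (h4.trans_lt hk)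
  filter_upwards [h5] with n hn
  refine lt_of_le_of_lt ?_ hn
  exact (Measure.map_apply_of_aemeasurable (h.forall_aemeasurable n)
    (measurableSet_le measurable_const measurable_norm)).ge

/-- `o_p(1) · O_p(1) = o_p(1)`. -/
lemma tendsto_mul_norm_probFilter [IsProbabilityMeasure P] {E : Type*}
    [NormedAddCommGroup E] [MeasurableSpace E] [BorelSpace E]
    {S' : Type*} [MeasurableSpace S'] {P' : Measure S'} [IsProbabilityMeasure P']
    {X : ℕ → S → E} {Y : S' → E}
    (h : TendstoInDistribution X atTop Y (fun _ => P) P') {a : ℕ × S → ℝ}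
    (ha : Tendsto a (probFilter P) (𝓝 0)) :
    Tendsto (fun p : ℕ × S => a p * ‖X p.1 p.2‖) (probFilter P) (𝓝 0) := by
  rw [Metric.tendsto_nhds]
  intro ε hε
  rw [eventually_probFilter, ENNReal.tendsto_nhds_zero]
  intro η hη
  obtain ⟨K, hK, hKη⟩ := exists_eventually_measure_norm_ge_lt h (ENNReal.half_pos hη.ne')
  have h1 : ∀ᶠ p in probFilter P, dist (a p) 0 < ε / K :=
    Metric.tendsto_nhds.1 ha _ (by positivity)
  rw [eventually_probFilter, ENNReal.tendsto_nhds_zero] at h1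
  filter_upwards [hKη, h1 _ (ENNReal.half_pos hη.ne')] with n hn1 hn2
  have hsub : {ω | ¬ dist (a (n, ω) * ‖X n ω‖) 0 < ε} ⊆
      {ω | ¬ dist (a (n, ω)) 0 < ε / K} ∪ {ω | K ≤ ‖X n ω‖} := by
    intro ω hω
    by_contra hc
    simp only [Set.mem_union, Set.mem_ofPred_eq, not_or, not_not, not_le] at hc
    apply hω
    rw [dist_zero_right, norm_mul, norm_norm]
    rw [dist_zero_right] at hc
    calc ‖a (n, ω)‖ * ‖X n ω‖ ≤ ‖a (n, ω)‖ * K := by gcongr; exact hc.2.le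
      _ < ε / K * K := by gcongr; exact hc.1
      _ = ε := by field_simp
  calc _ ≤ _ := measure_mono hsub
    _ ≤ _ := measure_union_le _ _
    _ ≤ η / 2 + η / 2 := add_le_add hn2 hn1.le
    _ = η := ENNReal.add_halves η

end ProbFilter

/-! ### Laws of large numbers and central limit theorem for an i.i.d. sample -/

/-- The mean of the first `n` terms of `a` (zero for `n = 0`). -/
def empMean (n : ℕ) (a : ℕ → ℝ) : ℝ :=
  (1 / (n : ℝ)) * ∑ i ∈ Finset.range n, a i

lemma empMean_add (n : ℕ) (a b : ℕ → ℝ) :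
    empMean n (fun i => a i + b i) = empMean n a + empMean n b := by
  simp only [empMean, Finset.sum_add_distrib, mul_add]

lemma empMean_const_mul (n : ℕ) (c : ℝ) (a : ℕ → ℝ) :
    empMean n (fun i => c * a i) = c * empMean n a := by
  simp only [empMean, ← Finset.mul_sum]
  ring

lemma empMean_sum {ι : Type*} (s : Finset ι) (n : ℕ) (a : ι → ℕ → ℝ) :
    empMean n (fun i => ∑ k ∈ s, a k i) = ∑ k ∈ s, empMean n (a k) := by
  simp only [empMean]
  rw [Finset.sum_comm, Finset.mul_sum]

lemma empMean_mono {n : ℕ} {a b : ℕ → ℝ} (h : ∀ i, a i ≤ b i) : empMean n a ≤ empMean n b :=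
  mul_le_mul_of_nonneg_left (Finset.sum_le_sum fun i _ => h i) (by positivity)

lemma empMean_const_le (n : ℕ) {c : ℝ} (hc : 0 ≤ c) : empMean n (fun _ => c) ≤ c := by
  rcases Nat.eq_zero_or_pos n with rfl | hn
  · simpa [empMean] using hc
  · have : (0 : ℝ) < n := by exact_mod_cast hn
    simp [empMean, this.ne']

lemma abs_empMean_le (n : ℕ) (a : ℕ → ℝ) : |empMean n a| ≤ empMean n fun i => |a i| := by
  rw [empMean, abs_mul, abs_of_nonneg (by positivity : (0 : ℝ) ≤ 1 / n)]
  exact mul_le_mul_of_nonneg_left (Finset.abs_sum_le_sum_abs _ _) (by positivity)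

/-- `Z` is an i.i.d. sample of the law `ρ`. -/
structure IsSample {S 𝓩 : Type*} [MeasurableSpace S] [MeasurableSpace 𝓩] (P : Measure S)
    (ρ : Measure 𝓩) (Z : ℕ → S → 𝓩) : Prop where
  measurable : ∀ i, Measurable (Z i)
  map_eq : ∀ i, P.map (Z i) = ρ
  indep : iIndepFun Z P

namespace IsSample

variable {S 𝓩 : Type*} [MeasurableSpace S] [MeasurableSpace 𝓩] {P : Measure S} {ρ : Measure 𝓩}
  {Z : ℕ → S → 𝓩}

lemma ae (h : IsSample P ρ Z) {Q : 𝓩 → Prop} (hQ : ∀ᵐ p ∂ρ, Q p) : ∀ᵐ ω ∂P, ∀ i, Q (Z i ω) := by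
  rw [ae_all_iff]
  intro i
  rw [← h.map_eq i] at hQ
  exact ae_of_ae_map (h.measurable i).aemeasurable hQ

lemma integral_comp (h : IsSample P ρ Z) {f : 𝓩 → ℝ} (hf : AEStronglyMeasurable f ρ) (i : ℕ) :
    ∫ ω, f (Z i ω) ∂P = ∫ p, f p ∂ρ := by
  rw [← h.map_eq i] at hf ⊢
  exact (integral_map (h.measurable i).aemeasurable hf).symm

lemma identDistrib (h : IsSample P ρ Z) {F : Type*} [MeasurableSpace F] {f : 𝓩 → F}
    (hf : AEMeasurable f ρ) (i : ℕ) :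
    IdentDistrib (fun ω => f (Z i ω)) (fun ω => f (Z 0 ω)) P P :=
  IdentDistrib.comp_of_aemeasurable
    ⟨(h.measurable i).aemeasurable, (h.measurable 0).aemeasurable, by rw [h.map_eq, h.map_eq]⟩
    (by rwa [h.map_eq])

lemma iIndepFun_comp (h : IsSample P ρ Z) {F : Type*} [MeasurableSpace F] {f : 𝓩 → F}
    (hf : AEMeasurable f ρ) : iIndepFun (fun i ω => f (Z i ω)) P :=
  h.indep.comp₀ (fun _ => f) (fun i => (h.measurable i).aemeasurable)
    fun i => by rwa [h.map_eq]

lemma aemeasurable_comp (h : IsSample P ρ Z) {F : Type*} [MeasurableSpace F] {f : 𝓩 → F}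
    (hf : AEMeasurable f ρ) (i : ℕ) : AEMeasurable (fun ω => f (Z i ω)) P :=
  (h.identDistrib hf i).aemeasurable_fst

lemma tendsto_empMean [IsFiniteMeasure P] (h : IsSample P ρ Z) {f : 𝓩 → ℝ} (hf : Integrable f ρ) :
    Tendsto (fun p : ℕ × S => empMean p.1 fun i => f (Z i p.2))
      (probFilter P) (𝓝 (∫ p, f p ∂ρ)) := by
  have hm := hf.aestronglyMeasurable.aemeasurable
  refine tendsto_probFilter_of_ae
    (f := fun n ω => empMean n fun i => f (Z i ω)) (fun n => ?_) ?_
  · exact ((Finset.aemeasurable_fun_sum _ fun i _ => h.aemeasurable_comp hm i).const_mul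
      _).aestronglyMeasurable
  · have hint : Integrable (fun ω => f (Z 0 ω)) P := by
      rw [← h.map_eq 0] at hf
      exact hf.comp_measurable (h.measurable 0)
    have := strong_law_ae_real (fun i ω => f (Z i ω)) hint
      (fun i j hij => (h.iIndepFun_comp hm).indepFun hij) (h.identDistrib hm)
    rw [h.integral_comp hf.aestronglyMeasurable] at this
    simpa [empMean, div_eq_inv_mul] using this

end IsSample

section CentralLimit

variable {S 𝓩 : Type*} [MeasurableSpace S] [MeasurableSpace 𝓩] {P : Measure S}
  [IsProbabilityMeasure P] {ρ : Measure 𝓩} {Z : ℕ → S → 𝓩} {q : ℕ}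
  {f : 𝓩 → EuclideanSpace ℝ (Fin q)} {C : Matrix (Fin q) (Fin q) ℝ}

lemma memLp_coord (hf : MemLp f 2 ρ) (j : Fin q) : MemLp (fun p => f p j) 2 ρ :=
  (EuclideanSpace.proj (𝕜 := ℝ) j).comp_memLp' hf

/-- The quadratic form of the second moment matrix of `f`. -/
lemma dotProduct_mulVec_eq_integral (hf : MemLp f 2 ρ)
    (hC : ∀ j k, C j k = ∫ p, f p j * f p k ∂ρ) (t : Fin q → ℝ) :
    t ⬝ᵥ C.mulVec t = ∫ p, (∑ j, t j * f p j) ^ 2 ∂ρ := by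
  have hint : ∀ j k, Integrable (fun p => t j * (f p j * f p k * t k)) ρ := fun j k =>
    ((((memLp_coord hf j).integrable_mul (memLp_coord hf k)).mul_const (t k)).const_mul (t j))
  have h1 : ∀ p, (∑ j, t j * f p j) ^ 2 = ∑ j, ∑ k, t j * (f p j * f p k * t k) := fun p => by
    rw [sq, Finset.sum_mul_sum]
    exact Finset.sum_congr rfl fun j _ => Finset.sum_congr rfl fun k _ => by ring
  simp_rw [h1]
  rw [integral_finsetSum _ fun j _ => integrable_finsetSum _ fun k _ => hint j k]
  simp only [dotProduct, Matrix.mulVec, Finset.mul_sum]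
  refine Finset.sum_congr rfl fun j _ => ?_
  rw [integral_finsetSum _ fun k _ => hint j k]
  refine Finset.sum_congr rfl fun k _ => ?_
  rw [integral_const_mul, integral_mul_const, hC]

lemma posSemidef_of_eq_integral (hf : MemLp f 2 ρ)
    (hC : ∀ j k, C j k = ∫ p, f p j * f p k ∂ρ) : C.PosSemidef := by
  refine Matrix.PosSemidef.of_dotProduct_mulVec_nonneg ?_ fun t => ?_
  · ext j k
    simp only [Matrix.conjTranspose_apply, star_trivial, hC]
    exact integral_congr_ae (ae_of_all _ fun p => mul_comm _ _)
  · rw [star_trivial, dotProduct_mulVec_eq_integral hf hC]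
    exact integral_nonneg fun p => sq_nonneg _

/-- The multivariate central limit theorem, from the one-dimensional one by way of
characteristic functions. -/
lemma IsSample.tendstoInDistribution (h : IsSample P ρ Z) (hf : MemLp f 2 ρ)
    (h0 : ∀ j, ∫ p, f p j ∂ρ = 0) (hC : ∀ j k, C j k = ∫ p, f p j * f p k ∂ρ) :
    TendstoInDistribution
      (fun (n : ℕ) ω => (√(n : ℝ))⁻¹ • ∑ i ∈ Finset.range n, f (Z i ω)) atTop
      (id : EuclideanSpace ℝ (Fin q) → EuclideanSpace ℝ (Fin q)) (fun _ => P)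
      (multivariateGaussian 0 C) := by
  have hfm := hf.aestronglyMeasurable.aemeasurable
  have hm : ∀ n : ℕ, AEMeasurable
      (fun ω => (√(n : ℝ))⁻¹ • ∑ i ∈ Finset.range n, f (Z i ω)) P := fun n =>
    (Finset.aemeasurable_fun_sum _ fun i _ => h.aemeasurable_comp hfm i).fun_const_smul _
  refine ⟨hm, aemeasurable_id, ?_⟩
  refine ProbabilityMeasure.tendsto_iff_tendsto_charFun.2 fun t => ?_
  -- the projection of the sample on the direction `t`
  set φ : 𝓩 → ℝ := fun p => ∑ j, t j * f p j with hφ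
  have hφL : MemLp φ 2 ρ := memLp_finsetSum _ fun j _ => (memLp_coord hf j).const_mul _
  have hφm := hφL.aestronglyMeasurable.aemeasurable
  have hφ0 : ∫ ω, φ (Z 0 ω) ∂P = 0 := by
    have : IsProbabilityMeasure ρ := by
      rw [← h.map_eq 0]; exact Measure.isProbabilityMeasure_map (h.measurable 0).aemeasurable
    rw [h.integral_comp hφL.aestronglyMeasurable, hφ, integral_finsetSum _ fun j _ =>
      ((memLp_coord hf j).integrable (by norm_num)).const_mul _]
    simp [integral_const_mul, h0]
  have hφL' : MemLp (fun ω => φ (Z 0 ω)) 2 P := by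
    rw [← h.map_eq 0] at hφL
    exact hφL.comp_of_map (h.measurable 0).aemeasurable
  have hvar : Var[fun ω => φ (Z 0 ω); P] = t ⬝ᵥ C.mulVec t := by
    rw [variance_eq_integral hφL'.aemeasurable, hφ0, dotProduct_mulVec_eq_integral hf hC]
    simp only [sub_zero]
    exact h.integral_comp (f := fun p => φ p ^ 2) (hφL.aestronglyMeasurable.pow 2) 0
  have hclt := tendstoInDistribution_inv_sqrt_mul_sum_sub (P := P)
    (X := fun i ω => φ (Z i ω)) (Y := id)
    (P' := gaussianReal 0 Var[fun ω => φ (Z 0 ω); P].toNNReal) HasLaw.id hφL'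
    (h.iIndepFun_comp hφm) (h.identDistrib hφm)
  have h1 := ProbabilityMeasure.tendsto_iff_tendsto_charFun.1 hclt.tendsto 1
  simp only [ProbabilityMeasure.coe_mk, Measure.map_id] at h1 ⊢
  have hψ := posSemidef_of_eq_integral hf hC
  have hlim : charFun (multivariateGaussian 0 C) t =
      charFun (gaussianReal 0 Var[fun ω => φ (Z 0 ω); P].toNNReal) 1 := by
    rw [charFun_multivariateGaussian hψ, charFun_gaussianReal, hvar]
    have : 0 ≤ (t : Fin q → ℝ) ⬝ᵥ C.mulVec t := by
      rw [← hvar]; exact variance_nonneg _ _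
    simp [Real.coe_toNNReal _ this]
  rw [hlim]
  refine h1.congr fun n => ?_
  rw [charFun_apply, charFun_apply, integral_map (hclt.forall_aemeasurable n) (by fun_prop),
    integral_map (hm n) (by fun_prop)]
  refine integral_congr_ae (ae_of_all _ fun ω => ?_)
  simp only [hφ0, mul_zero, sub_zero]
  congr 3
  have : ∀ i, φ (Z i ω) = inner ℝ (f (Z i ω)) t := fun i => by
    simp [hφ, PiLp.inner_apply]
  simp [inner_smul_left, sum_inner, this]

/-- An estimator with an asymptotically linear expansion is asymptotically normal, its covariance
matrix being the second moment matrix of the influence function `f`. -/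
lemma IsSample.hasAsymptoticCovariance (h : IsSample P ρ Z) (hf : MemLp f 2 ρ)
    (h0 : ∀ j, ∫ p, f p j ∂ρ = 0) (hC : ∀ j k, C j k = ∫ p, f p j * f p k ∂ρ)
    {T : ℕ → S → EuclideanSpace ℝ (Fin q)} {θ : EuclideanSpace ℝ (Fin q)}
    (hT : ∀ n, AEMeasurable (T n) P)
    (hexp : IsLittleOpInvSqrt P fun n ω =>
      ‖T n ω - θ - (1 / (n : ℝ)) • ∑ i ∈ Finset.range n, f (Z i ω)‖ₑ) :
    HasAsymptoticCovariance P T θ C := by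
  refine ⟨posSemidef_of_eq_integral hf hC, ?_⟩
  refine tendstoInDistribution_of_tendstoInMeasure_sub _ _ (h.tendstoInDistribution hf h0 hC) ?_
    fun n => ((hT n).sub_const θ).fun_const_smul _
  refine tendstoInMeasure_const_iff.2 ?_
  refine tendsto_zero_iff_enorm_tendsto_zero.2 ?_
  refine (isLittleOpInvSqrt_iff.1 hexp).congr fun p => ?_
  rw [← Real.enorm_of_nonneg (Real.sqrt_nonneg _), ← enorm_smul, smul_sub, smul_smul]
  congr 2
  congr 2
  rcases Nat.eq_zero_or_pos p.1 with h | h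
  · simp [h]
  · field_simp
    rw [Real.sq_sqrt (by positivity)]

end CentralLimit

/-! ### The sample of the pairs of inputs and errors -/

section Pairs

variable {S 𝓧 : Type*} [MeasurableSpace S] [MeasurableSpace 𝓧] {P : Measure S}
  [IsProbabilityMeasure P]

/-- Two i.i.d. sequences that are independent of each other make an i.i.d. sequence of pairs. -/
lemma isSample_prodMk {𝓨 : Type*} [MeasurableSpace 𝓨] {μ : Measure 𝓧} {ν : Measure 𝓨}
    {x : ℕ → S → 𝓧} {e : ℕ → S → 𝓨} (hx : IsSample P μ x) (he : IsSample P ν e)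
    (hxe : IndepFun (fun ω i => x i ω) (fun ω i => e i ω) P) :
    IsSample P (μ.prod ν) (fun i ω => (x i ω, e i ω)) := by
  have hrect : ∀ (F : Finset ℕ) (A : ℕ → Set 𝓧) (B : ℕ → Set 𝓨), (∀ i ∈ F, MeasurableSet (A i)) →
      (∀ i ∈ F, MeasurableSet (B i)) →
      P (⋂ i ∈ F, (x i ⁻¹' A i ∩ e i ⁻¹' B i)) =
        ∏ i ∈ F, (P (x i ⁻¹' A i) * P (e i ⁻¹' B i)) := by
    intro F A B hA hB
    have h1 : ⋂ i ∈ F, (x i ⁻¹' A i ∩ e i ⁻¹' B i) =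
        (fun ω i => x i ω) ⁻¹' (Set.pi F A) ∩ (fun ω i => e i ω) ⁻¹' (Set.pi F B) := by
      ext ω
      simp only [Set.mem_iInter, Set.mem_inter_iff, Set.mem_preimage, Set.mem_pi,
        Finset.mem_coe]
      exact ⟨fun h => ⟨fun i hi => (h i hi).1, fun i hi => (h i hi).2⟩,
        fun h i hi => ⟨h.1 i hi, h.2 i hi⟩⟩
    have h2 : (fun ω i => x i ω) ⁻¹' (Set.pi F A) = ⋂ i ∈ F, x i ⁻¹' A i := by
      ext ω; simp
    have h3 : (fun ω i => e i ω) ⁻¹' (Set.pi F B) = ⋂ i ∈ F, e i ⁻¹' B i := by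
      ext ω; simp
    rw [h1, hxe.measure_inter_preimage_eq_mul _ _ (MeasurableSet.pi F.countable_toSet hA)
      (MeasurableSet.pi F.countable_toSet hB), h2, h3,
      (iIndepFun_iff_measure_inter_preimage_eq_mul.1 hx.indep) F hA,
      (iIndepFun_iff_measure_inter_preimage_eq_mul.1 he.indep) F hB, Finset.prod_mul_distrib]
  refine ⟨fun i => (hx.measurable i).prodMk (he.measurable i), fun i => ?_, ?_⟩
  · have hi : IndepFun (x i) (e i) P :=
      hxe.comp (measurable_pi_apply i) (measurable_pi_apply i)
    rw [(indepFun_iff_map_prod_eq_prod_map_map (hx.measurable i).aemeasurable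
      (he.measurable i).aemeasurable).1 hi, hx.map_eq, he.map_eq]
  · let π : ℕ → Set (Set S) := fun i =>
      {s | ∃ A B, MeasurableSet A ∧ MeasurableSet B ∧ s = x i ⁻¹' A ∩ e i ⁻¹' B}
    refine iIndepSets.iIndep (π := π)
      (fun i => ((hx.measurable i).prodMk (he.measurable i)).comap_le) ?_ ?_ ?_
    · rintro i _ ⟨A, B, hA, hB, rfl⟩ _ ⟨A', B', hA', hB', rfl⟩ -
      refine ⟨A ∩ A', B ∩ B', hA.inter hA', hB.inter hB', ?_⟩
      ext ω
      simp only [Set.mem_inter_iff, Set.mem_preimage]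
      tauto
    · intro i
      rw [← generateFrom_prod, MeasurableSpace.comap_generateFrom]
      congr 1
      ext s
      constructor
      · rintro ⟨_, ⟨A, hA, B, hB, rfl⟩, rfl⟩
        exact ⟨A, B, hA, hB, by ext; simp⟩
      · rintro ⟨A, B, hA, hB, rfl⟩
        exact ⟨_, ⟨A, hA, B, hB, rfl⟩, by ext; simp⟩
    · rw [iIndepSets_iff]
      intro F s hs
      choose! A B hA hB hAB using hs
      have h1 : ⋂ i ∈ F, s i = ⋂ i ∈ F, (x i ⁻¹' A i ∩ e i ⁻¹' B i) :=
        Set.iInter₂_congr fun i hi => hAB i hi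
      rw [h1, hrect F A B hA hB]
      refine Finset.prod_congr rfl fun i hi => ?_
      have := hrect {i} A B (by simpa using hA i hi) (by simpa using hB i hi)
      simp only [Finset.mem_singleton, Set.iInter_iInter_eq_left, Finset.prod_singleton] at this
      rw [hAB i hi, this]

end Pairs

/-! ### Taylor expansion and square integrability of the derivatives -/

section Taylor

variable {E : Type*} [NormedAddCommGroup E] [NormedSpace ℝ E]

/-- `f` is of class `C²` on the ball of radius `r` around `θ₀`, and its second derivative deviates
from the one at `θ₀` by at most `ℓ` times the distance. -/
def IsC2LipAt (f : E → ℝ) (θ₀ : E) (r ℓ : ℝ) : Prop :=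
  ContDiffOn ℝ 2 f (Metric.ball θ₀ r) ∧ ∀ θ ∈ Metric.ball θ₀ r,
    ‖fderiv ℝ (fderiv ℝ f) θ - fderiv ℝ (fderiv ℝ f) θ₀‖ ≤ ℓ * ‖θ - θ₀‖

variable {f : E → ℝ} {θ₀ : E} {r ℓ : ℝ}

lemma IsC2LipAt.contDiffAt (hf : IsC2LipAt f θ₀ r ℓ) {θ : E} (hθ : θ ∈ Metric.ball θ₀ r) :
    ContDiffAt ℝ 2 f θ :=
  hf.1.contDiffAt (Metric.isOpen_ball.mem_nhds hθ)

lemma IsC2LipAt.hasFDerivAt (hf : IsC2LipAt f θ₀ r ℓ) {θ : E} (hθ : θ ∈ Metric.ball θ₀ r) :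
    HasFDerivAt f (fderiv ℝ f θ) θ :=
  ((hf.contDiffAt hθ).differentiableAt (by norm_num)).hasFDerivAt

lemma IsC2LipAt.hasFDerivAt_fderiv (hf : IsC2LipAt f θ₀ r ℓ) {θ : E}
    (hθ : θ ∈ Metric.ball θ₀ r) : HasFDerivAt (fderiv ℝ f) (fderiv ℝ (fderiv ℝ f) θ) θ :=
  (((hf.contDiffAt hθ).fderiv_right (m := 1) (by norm_num)).differentiableAt
    (by norm_num)).hasFDerivAt

lemma IsC2LipAt.symm (hf : IsC2LipAt f θ₀ r ℓ) (hr : 0 < r) (h k : E) :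
    fderiv ℝ (fderiv ℝ f) θ₀ h k = fderiv ℝ (fderiv ℝ f) θ₀ k h :=
  (hf.contDiffAt (Metric.mem_ball_self hr)).isSymmSndFDerivAt (by simp) h k

lemma mem_ball_of_mem_closedBall {E : Type*} [NormedAddCommGroup E] {θ₀ h x : E} {r : ℝ}
    (hh : ‖h‖ < r) (hx : x ∈ Metric.closedBall θ₀ ‖h‖) : x ∈ Metric.ball θ₀ r :=
  Metric.closedBall_subset_ball hh hx

/-- First-order expansion of the derivative. -/
lemma IsC2LipAt.norm_fderiv_sub_le (hf : IsC2LipAt f θ₀ r ℓ) (hℓ : 0 ≤ ℓ) {h : E}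
    (hh : ‖h‖ < r) :
    ‖fderiv ℝ f (θ₀ + h) - fderiv ℝ f θ₀ - fderiv ℝ (fderiv ℝ f) θ₀ h‖ ≤ ℓ * ‖h‖ ^ 2 := by
  have := Convex.norm_image_sub_le_of_norm_hasFDerivWithin_le' (𝕜 := ℝ) (f := fderiv ℝ f)
    (f' := fun θ => fderiv ℝ (fderiv ℝ f) θ) (φ := fderiv ℝ (fderiv ℝ f) θ₀) (C := ℓ * ‖h‖)
    (s := Metric.closedBall θ₀ ‖h‖) (x := θ₀) (y := θ₀ + h)
    (fun x hx => (hf.hasFDerivAt_fderiv (mem_ball_of_mem_closedBall hh hx)).hasFDerivWithinAt)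
    (fun x hx => (hf.2 x (mem_ball_of_mem_closedBall hh hx)).trans (by
      gcongr; simpa [dist_eq_norm] using hx))
    (convex_closedBall _ _) (by simp) (by simp)
  simpa [sq, mul_assoc] using this

/-- Second-order expansion of the function. -/
lemma IsC2LipAt.abs_sub_le (hf : IsC2LipAt f θ₀ r ℓ) (hℓ : 0 ≤ ℓ) {h : E} (hh : ‖h‖ < r) :
    |f (θ₀ + h) - f θ₀ - fderiv ℝ f θ₀ h - 2⁻¹ * fderiv ℝ (fderiv ℝ f) θ₀ h h| ≤
      ℓ * ‖h‖ ^ 3 := by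
  set A := fderiv ℝ (fderiv ℝ f) θ₀ with hA
  have hr : 0 < r := (norm_nonneg h).trans_lt hh
  have hsymm : ∀ u v, A u v = A v u := hf.symm hr
  have hquad : ∀ x, HasFDerivAt (fun θ => 2⁻¹ * A (θ - θ₀) (θ - θ₀)) (A (x - θ₀)) x := by
    intro x
    have h1 : HasFDerivAt (fun θ : E => θ - θ₀) (ContinuousLinearMap.id ℝ E) x :=
      (hasFDerivAt_id x).sub_const θ₀
    have h2 := ((A.hasFDerivAt.comp x h1).clm_apply h1).const_mul (2⁻¹ : ℝ)
    refine h2.congr_fderiv ?_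
    ext v
    simp only [Function.comp_apply, smul_apply, add_apply,
      ContinuousLinearMap.comp_apply, ContinuousLinearMap.flip_apply,
      ContinuousLinearMap.id_apply, smul_eq_mul, hsymm v (x - θ₀)]
    ring
  have := Convex.norm_image_sub_le_of_norm_hasFDerivWithin_le' (𝕜 := ℝ)
    (f := fun θ => f θ - 2⁻¹ * A (θ - θ₀) (θ - θ₀))
    (f' := fun θ => fderiv ℝ f θ - A (θ - θ₀)) (φ := fderiv ℝ f θ₀) (C := ℓ * ‖h‖ ^ 2)
    (s := Metric.closedBall θ₀ ‖h‖) (x := θ₀) (y := θ₀ + h)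
    (fun x hx => ((hf.hasFDerivAt (mem_ball_of_mem_closedBall hh hx)).sub
      (hquad x)).hasFDerivWithinAt)
    (fun x hx => by
      have hx' : ‖x - θ₀‖ ≤ ‖h‖ := by simpa [dist_eq_norm] using hx
      have := hf.norm_fderiv_sub_le hℓ (hx'.trans_lt hh)
      rw [add_sub_cancel] at this
      rw [sub_right_comm]
      exact this.trans (by gcongr))
    (convex_closedBall _ _) (by simp) (by simp)
  simp only [add_sub_cancel_left, sub_self, map_zero, mul_zero, sub_zero, Real.norm_eq_abs] at this
  calc _ = |f (θ₀ + h) - 2⁻¹ * A h h - f θ₀ - fderiv ℝ f θ₀ h| := by congr 1; ring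
    _ ≤ _ := this
    _ = _ := by ring

end Taylor

section SquareIntegrable

variable {𝓧 : Type*} [MeasurableSpace 𝓧] {μ : Measure 𝓧}
  {E : Type*} [NormedAddCommGroup E] [NormedSpace ℝ E]
  {f : 𝓧 → E → ℝ} {θ₀ : E} {r : ℝ} {L : 𝓧 → ℝ}

/-- A pointwise limit of square integrable functions is square integrable if the rate of
convergence is controlled by a square integrable function. -/
lemma memLp_of_abs_sub_le {u : ℕ → 𝓧 → ℝ} {g K : 𝓧 → ℝ} {ε : ℕ → ℝ} (hu : ∀ n, MemLp (u n) 2 μ)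
    (hK : MemLp K 2 μ) (hε : Tendsto ε atTop (𝓝 0))
    (h : ∀ᵐ z ∂μ, ∀ n, |u n z - g z| ≤ ε n * K z) : MemLp g 2 μ := by
  have hg : AEStronglyMeasurable g μ := by
    refine aestronglyMeasurable_of_tendsto_ae atTop (fun n => (hu n).aestronglyMeasurable) ?_
    filter_upwards [h] with z hz
    rw [tendsto_iff_norm_sub_tendsto_zero]
    exact squeeze_zero (fun _ => norm_nonneg _) hz (by simpa using hε.mul_const (K z))
  have h1 : MemLp (fun z => u 0 z - g z) 2 μ := by
    refine (hK.const_mul (ε 0)).mono ((hu 0).aestronglyMeasurable.sub hg) ?_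
    filter_upwards [h] with z hz
    exact (hz 0).trans (le_abs_self _)
  have := (hu 0).sub h1
  refine this.ae_eq (ae_of_all _ fun z => ?_)
  simp

lemma norm_step_lt (hr : 0 < r) (h : E) (n : ℕ) :
    ‖(r / (‖h‖ + 1) / ((n : ℝ) + 2)) • h‖ < r := by
  have h1 : 0 ≤ ‖h‖ := norm_nonneg h
  rw [norm_smul, Real.norm_of_nonneg (by positivity), div_div, div_mul_eq_mul_div,
    div_lt_iff₀ (by positivity)]
  have : ‖h‖ < (‖h‖ + 1) * ((n : ℝ) + 2) := by
    have : (0 : ℝ) ≤ n := n.cast_nonneg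
    nlinarith
  exact mul_lt_mul_of_pos_left this hr

lemma tendsto_step (c : ℝ) : Tendsto (fun n : ℕ => c / ((n : ℝ) + 2)) atTop (𝓝 0) :=
  tendsto_const_nhds.div_atTop (tendsto_atTop_add_const_right _ _ tendsto_natCast_atTop_atTop)

/-- The first derivatives at `θ₀` are limits of difference quotients, and hence square integrable
like the functions themselves. -/
lemma memLp_fderiv (hr : 0 < r) (hf : ∀ θ ∈ Metric.ball θ₀ r, MemLp (fun z => f z θ) 2 μ)
    (hL0 : ∀ z, 0 ≤ L z) (hL : MemLp L 2 μ) (hC : ∀ᵐ z ∂μ, IsC2LipAt (f z) θ₀ r (L z)) (h : E) :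
    MemLp (fun z => fderiv ℝ (f z) θ₀ h) 2 μ := by
  set t : ℕ → ℝ := fun n => r / (‖h‖ + 1) / ((n : ℝ) + 2) with ht
  have htpos : ∀ n, 0 < t n := fun n => by
    have := norm_nonneg h
    positivity
  have hlt : ∀ n, ‖t n • h‖ < r := norm_step_lt hr h
  refine memLp_of_abs_sub_le
    (u := fun n z => (2 * t n)⁻¹ * (f z (θ₀ + t n • h) - f z (θ₀ - t n • h)))
    (K := L) (ε := fun n => t n ^ 2 * ‖h‖ ^ 3) (fun n => ?_) hL ?_ ?_
  · refine ((hf _ ?_).sub (hf _ ?_)).const_mul _ <;> simpa [dist_eq_norm] using hlt n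
  · simpa using ((tendsto_step (r / (‖h‖ + 1))).pow 2).mul_const (‖h‖ ^ 3)
  · filter_upwards [hC] with z hz n
    have h1 := hz.abs_sub_le (hL0 z) (hlt n)
    have h2 := hz.abs_sub_le (hL0 z) (h := -(t n • h)) (by simpa using hlt n)
    simp only [map_neg, map_smul, smul_eq_mul, norm_neg, neg_apply,
      smul_apply, norm_smul, ← sub_eq_add_neg,
      Real.norm_of_nonneg (htpos n).le] at h1 h2
    have h3 : (2 * t n)⁻¹ * (f z (θ₀ + t n • h) - f z (θ₀ - t n • h)) - fderiv ℝ (f z) θ₀ h =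
        (2 * t n)⁻¹ * (f z (θ₀ + t n • h) - f z (θ₀ - t n • h)
          - 2 * t n * fderiv ℝ (f z) θ₀ h) := by
      rw [mul_sub (2 * t n)⁻¹ (_ - _), inv_mul_cancel_left₀ (by have := htpos n; positivity)]
    rw [h3, abs_mul, abs_of_pos (by have := htpos n; positivity),
      inv_mul_le_iff₀ (by have := htpos n; positivity)]
    rw [abs_le] at h1 h2 ⊢
    constructor <;> nlinarith

/-- The second derivatives at `θ₀` are square integrable, being limits of second difference
quotients. -/
lemma memLp_fderiv_fderiv (hr : 0 < r)
    (hf : ∀ θ ∈ Metric.ball θ₀ r, MemLp (fun z => f z θ) 2 μ)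
    (hL0 : ∀ z, 0 ≤ L z) (hL : MemLp L 2 μ) (hC : ∀ᵐ z ∂μ, IsC2LipAt (f z) θ₀ r (L z))
    (h k : E) : MemLp (fun z => fderiv ℝ (fderiv ℝ (f z)) θ₀ h k) 2 μ := by
  have hdiag : ∀ h : E, MemLp (fun z => fderiv ℝ (fderiv ℝ (f z)) θ₀ h h) 2 μ := by
    intro h
    set t : ℕ → ℝ := fun n => r / (‖h‖ + 1) / ((n : ℝ) + 2) with ht
    have htpos : ∀ n, 0 < t n := fun n => by
      have := norm_nonneg h
      positivity
    have hlt : ∀ n, ‖t n • h‖ < r := norm_step_lt hr h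
    refine memLp_of_abs_sub_le
      (u := fun n z => (t n ^ 2)⁻¹ * (f z (θ₀ + t n • h) + f z (θ₀ - t n • h) - 2 * f z θ₀))
      (K := L) (ε := fun n => 2 * (t n * ‖h‖ ^ 3)) (fun n => ?_) hL ?_ ?_
    · refine (((hf _ ?_).add (hf _ ?_)).sub
        ((hf θ₀ (Metric.mem_ball_self hr)).const_mul 2)).const_mul _ <;>
        simpa [dist_eq_norm] using hlt n
    · simpa using (((tendsto_step (r / (‖h‖ + 1)))).mul_const (‖h‖ ^ 3)).const_mul 2
    · filter_upwards [hC] with z hz n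
      have h1 := hz.abs_sub_le (hL0 z) (hlt n)
      have h2 := hz.abs_sub_le (hL0 z) (h := -(t n • h)) (by simpa using hlt n)
      simp only [map_neg, map_smul, smul_eq_mul, norm_neg, neg_apply,
        smul_apply, norm_smul, ← sub_eq_add_neg,
        Real.norm_of_nonneg (htpos n).le] at h1 h2
      set H := fderiv ℝ (fderiv ℝ (f z)) θ₀ h h with hH
      have h3 : (t n ^ 2)⁻¹ * (f z (θ₀ + t n • h) + f z (θ₀ - t n • h) - 2 * f z θ₀) - H =
          (t n ^ 2)⁻¹ * (f z (θ₀ + t n • h) + f z (θ₀ - t n • h) - 2 * f z θ₀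
            - t n ^ 2 * H) := by
        rw [mul_sub (t n ^ 2)⁻¹ (_ - _), inv_mul_cancel_left₀ (by have := htpos n; positivity)]
      rw [h3, abs_mul, abs_of_pos (by have := htpos n; positivity),
        inv_mul_le_iff₀ (by have := htpos n; positivity)]
      rw [abs_le] at h1 h2 ⊢
      constructor <;> nlinarith
  refine ((((hdiag (h + k)).sub (hdiag h)).sub (hdiag k)).const_mul 2⁻¹).ae_eq ?_
  filter_upwards [hC] with z hz
  have := hz.symm hr h k
  simp only [map_add, add_apply, Pi.sub_apply]
  rw [this]
  ring

/-- The first-order condition at an interior minimizer of the `L²` distance. -/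
lemma integral_mul_fderiv_eq_zero (hr : 0 < r)
    (hf : ∀ θ ∈ Metric.ball θ₀ r, MemLp (fun z => f z θ) 2 μ)
    (hL0 : ∀ z, 0 ≤ L z) (hL : MemLp L 2 μ) (hC : ∀ᵐ z ∂μ, IsC2LipAt (f z) θ₀ r (L z))
    {ζ : 𝓧 → ℝ} (hζ : MemLp (fun z => ζ z - f z θ₀) 2 μ)
    (hmin : ∀ θ ∈ Metric.ball θ₀ r,
      ∫ z, (ζ z - f z θ₀) ^ 2 ∂μ ≤ ∫ z, (ζ z - f z θ) ^ 2 ∂μ) (h : E) :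
    ∫ z, (ζ z - f z θ₀) * fderiv ℝ (f z) θ₀ h ∂μ = 0 := by
  set R : 𝓧 → ℝ := fun z => ζ z - f z θ₀ with hR
  set D : 𝓧 → ℝ := fun z => fderiv ℝ (f z) θ₀ h with hD
  set K : 𝓧 → ℝ := fun z => |fderiv ℝ (fderiv ℝ (f z)) θ₀ h h| + L z * ‖h‖ ^ 3 with hK
  have hDL : MemLp D 2 μ := memLp_fderiv hr hf hL0 hL hC h
  have hKL : MemLp K 2 μ :=
    (memLp_fderiv_fderiv hr hf hL0 hL hC h h).abs.add (hL.mul_const _)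
  have hK0 : ∀ z, 0 ≤ K z := fun z =>
    add_nonneg (abs_nonneg _) (mul_nonneg (hL0 z) (by positivity))
  set a := ∫ z, R z * D z ∂μ with ha
  set C := ∫ z, ((|D z| + K z) ^ 2 + 2 * (|R z| * K z)) ∂μ with hCdef
  have hDK : MemLp (fun z => |D z| + K z) 2 μ := hDL.abs.add hKL
  have hRK : Integrable (fun z => |R z| * K z) μ := hζ.abs.integrable_mul hKL
  have hRD : Integrable (fun z => R z * D z) μ := hζ.integrable_mul hDL
  -- moving from `θ₀` by `t h` does not decrease the distance
  have key : ∀ t : ℝ, |t| ≤ 1 → |t| * ‖h‖ < r → 2 * t * a ≤ t ^ 2 * C := by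
    intro t ht1 htr
    have htr' : ‖t • h‖ < r := by rwa [norm_smul, Real.norm_eq_abs]
    have hmem : θ₀ + t • h ∈ Metric.ball θ₀ r := by simpa [dist_eq_norm] using htr'
    set w : 𝓧 → ℝ := fun z => f z (θ₀ + t • h) - f z θ₀ with hw
    have hwL : MemLp w 2 μ := (hf _ hmem).sub (hf θ₀ (Metric.mem_ball_self hr))
    have hRw : Integrable (fun z => R z * w z) μ := hζ.integrable_mul hwL
    have h1 : 2 * ∫ z, R z * w z ∂μ ≤ ∫ z, w z ^ 2 ∂μ := by
      have h2 := hmin _ hmem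
      have h3 : ∀ z, (ζ z - f z (θ₀ + t • h)) ^ 2 = R z ^ 2 - 2 * (R z * w z) + w z ^ 2 :=
        fun z => by simp only [hR, hw]; ring
      simp_rw [h3] at h2
      have h4 : Integrable (fun z => R z ^ 2 - 2 * (R z * w z)) μ :=
        hζ.integrable_sq.sub (hRw.const_mul 2)
      rw [integral_add h4 hwL.integrable_sq,
        integral_sub hζ.integrable_sq (hRw.const_mul 2), integral_const_mul] at h2
      linarith
    have h4 : ∀ᵐ z ∂μ, |w z - t * D z| ≤ t ^ 2 * K z := by
      filter_upwards [hC] with z hz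
      have h5 := hz.abs_sub_le (hL0 z) htr'
      simp only [map_smul, smul_eq_mul, smul_apply, norm_smul,
        Real.norm_eq_abs] at h5
      set H := fderiv ℝ (fderiv ℝ (f z)) θ₀ h h with hH
      have h6 : L z * (|t| * ‖h‖) ^ 3 ≤ t ^ 2 * (L z * ‖h‖ ^ 3) := by
        have : (|t| * ‖h‖) ^ 3 ≤ t ^ 2 * ‖h‖ ^ 3 := by
          rw [mul_pow, ← sq_abs t]
          gcongr ?_ * _
          exact pow_le_pow_of_le_one (abs_nonneg t) ht1 (by norm_num)
        calc _ ≤ L z * (t ^ 2 * ‖h‖ ^ 3) := mul_le_mul_of_nonneg_left this (hL0 z)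
          _ = _ := by ring
      have h7 : |2⁻¹ * (t * (t * H))| ≤ t ^ 2 * |H| := by
        rw [abs_mul, show t * (t * H) = t ^ 2 * H by ring, abs_mul, abs_of_nonneg (sq_nonneg t),
          abs_of_pos (by norm_num : (0 : ℝ) < 2⁻¹)]
        nlinarith [mul_nonneg (sq_nonneg t) (abs_nonneg H)]
      calc |w z - t * D z| = |(f z (θ₀ + t • h) - f z θ₀ - t * fderiv ℝ (f z) θ₀ h -
            2⁻¹ * (t * (t * H))) + 2⁻¹ * (t * (t * H))| := by
            simp only [hw, hD]; congr 1; ring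
        _ ≤ t ^ 2 * (L z * ‖h‖ ^ 3) + t ^ 2 * |H| :=
          (abs_add_le _ _).trans (add_le_add (h5.trans h6) h7)
        _ = t ^ 2 * K z := by simp only [hK, hH]; ring
    have h8 : ∫ z, (2 * t * (R z * D z)) ∂μ ≤
        ∫ z, (2 * (R z * w z) + t ^ 2 * (2 * (|R z| * K z))) ∂μ := by
      refine integral_mono_ae (hRD.const_mul _)
        ((hRw.const_mul 2).add ((hRK.const_mul 2).const_mul _)) ?_
      filter_upwards [h4] with z hz
      have : |R z * (t * D z - w z)| ≤ |R z| * (t ^ 2 * K z) := by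
        rw [abs_mul, abs_sub_comm (t * D z)]; gcongr
      have := (le_abs_self _).trans this
      linarith
    have h9 : ∫ z, w z ^ 2 ∂μ ≤ ∫ z, t ^ 2 * (|D z| + K z) ^ 2 ∂μ := by
      refine integral_mono_ae hwL.integrable_sq (hDK.integrable_sq.const_mul _) ?_
      filter_upwards [h4] with z hz
      have h10 : |w z| ≤ |t| * (|D z| + K z) := by
        have : t ^ 2 * K z ≤ |t| * K z := by
          refine mul_le_mul_of_nonneg_right ?_ (hK0 z)
          rw [← sq_abs]
          nlinarith [abs_nonneg t]
        calc |w z| = |(w z - t * D z) + t * D z| := by congr 1; ring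
          _ ≤ t ^ 2 * K z + |t * D z| := (abs_add_le _ _).trans (by gcongr)
          _ ≤ |t| * K z + |t| * |D z| := by rw [abs_mul]; gcongr
          _ = _ := by ring
      calc w z ^ 2 = |w z| ^ 2 := (sq_abs _).symm
        _ ≤ (|t| * (|D z| + K z)) ^ 2 := by gcongr
        _ = _ := by rw [mul_pow, sq_abs]
    rw [integral_const_mul, integral_add (hRw.const_mul 2) ((hRK.const_mul 2).const_mul _),
      integral_const_mul, integral_const_mul] at h8
    rw [integral_const_mul] at h9
    rw [hCdef, integral_add hDK.integrable_sq (hRK.const_mul 2), mul_add]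
    linarith
  -- both signs of a small `t` leave only `a = 0`
  have hstep : ∀ᶠ t : ℝ in 𝓝 0, |t| ≤ 1 ∧ |t| * ‖h‖ < r := by
    have c1 : Tendsto (fun t : ℝ => |t|) (𝓝 0) (𝓝 0) := by
      simpa using (continuous_abs.tendsto (0 : ℝ))
    have c2 : Tendsto (fun t : ℝ => |t| * ‖h‖) (𝓝 0) (𝓝 0) := by simpa using c1.mul_const ‖h‖
    exact (c1.eventually_le_const one_pos).and (c2.eventually_lt_const hr)
  have hlim : ∀ s : ℝ, Tendsto (fun t : ℝ => t * s) (𝓝[>] 0) (𝓝 0) := fun s => by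
    have : Tendsto (fun t : ℝ => t * s) (𝓝 0) (𝓝 (0 * s)) := (continuous_mul_const s).tendsto 0
    rw [zero_mul] at this
    exact this.mono_left nhdsWithin_le_nhds
  have hup : 2 * a ≤ 0 := by
    refine ge_of_tendsto (hlim C) ?_
    filter_upwards [hstep.filter_mono nhdsWithin_le_nhds, self_mem_nhdsWithin] with t ht ht0
    have ht0 : 0 < t := ht0
    have := key t ht.1 ht.2
    nlinarith
  have hdown : 2 * -a ≤ 0 := by
    refine ge_of_tendsto (hlim C) ?_
    filter_upwards [hstep.filter_mono nhdsWithin_le_nhds, self_mem_nhdsWithin] with t ht ht0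
    have ht0 : 0 < t := ht0
    have := key (-t) (by rw [abs_neg]; exact ht.1) (by rw [abs_neg]; exact ht.2)
    nlinarith
  linarith

end SquareIntegrable

/-! ### Consistency of least squares -/

section Consistency

variable {S 𝓩 E : Type*} [MeasurableSpace S] [MeasurableSpace 𝓩] {P : Measure S}
  {ρ : Measure 𝓩} {Z : ℕ → S → 𝓩} {Θ : Set E}

/-- Wald's argument: the infimum of a nonnegative criterion over a small ball has almost the same
mean as the criterion at the center. No integrable envelope is needed, since the infimum is
dominated by the value at the center. -/
lemma exists_ball_integral_lt [PseudoMetricSpace E] [TopologicalSpace.SeparableSpace E]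
    {m : E → 𝓩 → ℝ} (h0 : ∀ θ p, 0 ≤ m θ p) (hm : ∀ θ ∈ Θ, Integrable (m θ) ρ)
    (hcont : ∀ᵐ p ∂ρ, ContinuousOn (fun θ => m θ p) Θ) {θ₀ : E} (hθ₀ : θ₀ ∈ Θ) {c : ℝ}
    (hc : c < ∫ p, m θ₀ p ∂ρ) :
    ∃ r > 0, ∃ g : 𝓩 → ℝ, Integrable g ρ ∧ c < ∫ p, g p ∂ρ ∧
      ∀ᵐ p ∂ρ, ∀ θ ∈ Θ ∩ Metric.ball θ₀ r, g p ≤ m θ p := by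
  have hdense : ∀ k : ℕ, ∃ D ⊆ Θ ∩ Metric.ball θ₀ (1 / ((k : ℝ) + 1)), D.Countable ∧
      Θ ∩ Metric.ball θ₀ (1 / ((k : ℝ) + 1)) ⊆ closure D := fun k =>
    (TopologicalSpace.IsSeparable.of_separableSpace _).exists_countable_dense_subset
  choose D hDsub hDc hDcl using hdense
  have hmem : ∀ k : ℕ, θ₀ ∈ Θ ∩ Metric.ball θ₀ (1 / ((k : ℝ) + 1)) := fun k =>
    ⟨hθ₀, Metric.mem_ball_self (by positivity)⟩
  have hne : ∀ k, Nonempty (D k) := fun k =>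
    (closure_nonempty_iff.1 ⟨θ₀, hDcl k (hmem k)⟩).to_subtype
  set g : ℕ → 𝓩 → ℝ := fun k p => ⨅ θ : D k, m θ p with hg
  have hbdd : ∀ k p, BddBelow (Set.range fun θ : D k => m θ p) := fun k p =>
    ⟨0, by rintro _ ⟨θ, rfl⟩; exact h0 _ _⟩
  have hg0 : ∀ k p, 0 ≤ g k p := fun k p => Real.iInf_nonneg fun _ => h0 _ _
  have hle : ∀ᵐ p ∂ρ, ∀ k : ℕ, ∀ θ ∈ Θ ∩ Metric.ball θ₀ (1 / ((k : ℝ) + 1)), g k p ≤ m θ p := by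
    filter_upwards [hcont] with p hp k θ hθ
    have h1 : m θ p ∈ closure ((fun θ => m θ p) '' D k) :=
      ((hp θ hθ.1).mono ((hDsub k).trans Set.inter_subset_left)).mem_closure_image (hDcl k hθ)
    refine closure_minimal ?_ isClosed_Ici h1
    rintro _ ⟨θ', hθ', rfl⟩
    exact ciInf_le (hbdd k p) ⟨θ', hθ'⟩
  have hgm : ∀ k, AEStronglyMeasurable (g k) ρ := fun k => by
    have := (hDc k).to_subtype
    exact (AEMeasurable.iInf fun θ : D k =>
      (hm θ (hDsub k θ.2).1).aestronglyMeasurable.aemeasurable).aestronglyMeasurable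
  have hgb : ∀ k, ∀ᵐ p ∂ρ, ‖g k p‖ ≤ m θ₀ p := fun k => by
    filter_upwards [hle] with p hp
    rw [Real.norm_of_nonneg (hg0 k p)]
    exact hp k θ₀ (hmem k)
  have hlim : ∀ᵐ p ∂ρ, Tendsto (fun k => g k p) atTop (𝓝 (m θ₀ p)) := by
    filter_upwards [hle, hcont] with p hp hpc
    refine tendsto_order.2 ⟨fun b hb => ?_, fun b hb =>
      Eventually.of_forall fun k => (hp k θ₀ (hmem k)).trans_lt hb⟩
    obtain ⟨b', hb', hb''⟩ := exists_between hb
    obtain ⟨ε, hε, hball⟩ := Metric.mem_nhdsWithin_iff.1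
      ((hpc θ₀ hθ₀).eventually_const_lt hb'')
    have htend : Tendsto (fun k : ℕ => 1 / ((k : ℝ) + 1)) atTop (𝓝 0) :=
      tendsto_one_div_add_atTop_nhds_zero_nat
    filter_upwards [htend.eventually_lt_const hε] with k hk
    refine hb'.trans_le (le_ciInf fun θ => ?_)
    have := hDsub k θ.2
    exact le_of_lt (hball ⟨Metric.ball_subset_ball hk.le this.2, this.1⟩)
  have hint := tendsto_integral_of_dominated_convergence (m θ₀) hgm (hm θ₀ hθ₀) hgb hlim
  obtain ⟨k, hk⟩ := (hint.eventually_const_lt hc).exists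
  refine ⟨1 / ((k : ℝ) + 1), by positivity, g k, (hm θ₀ hθ₀).mono' (hgm k) (hgb k), hk, ?_⟩
  filter_upwards [hle] with p hp using hp k

lemma add_sq_le_of_abs_le {u v δ : ℝ} (hv : |v| ≤ δ) :
    (u + v) ^ 2 ≤ (1 + δ) * u ^ 2 + (δ + δ ^ 2) := by
  have h1 : v ^ 2 ≤ δ ^ 2 := sq_le_sq' (abs_le.1 hv).1 (abs_le.1 hv).2
  have h2 : 2 * (u * v) ≤ δ * (1 + u ^ 2) := by
    calc 2 * (u * v) ≤ 2 * (|u| * |v|) := by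
          rw [← abs_mul]; exact mul_le_mul_of_nonneg_left (le_abs_self _) (by norm_num)
      _ ≤ 2 * (|u| * δ) := by gcongr
      _ ≤ δ * (1 + u ^ 2) := by
          have : 0 ≤ δ := (abs_nonneg v).trans hv
          nlinarith [mul_nonneg this (sq_nonneg (1 - |u|)), sq_abs u]
  nlinarith

lemma empMean_sq_le {n : ℕ} {y a b : ℕ → ℝ} {δ : ℝ} (hab : ∀ i, |a i - b i| ≤ δ) :
    empMean n (fun i => (y i - b i) ^ 2) ≤
      (1 + δ) * empMean n (fun i => (y i - a i) ^ 2) + (δ + δ ^ 2) := by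
  have hδ : 0 ≤ δ := (abs_nonneg _).trans (hab 0)
  calc _ ≤ empMean n (fun i => (1 + δ) * (y i - a i) ^ 2 + (δ + δ ^ 2)) := by
        refine empMean_mono fun i => ?_
        have := add_sq_le_of_abs_le (u := y i - a i) (hab i)
        rwa [sub_add_sub_cancel] at this
    _ = (1 + δ) * empMean n (fun i => (y i - a i) ^ 2) + empMean n fun _ => δ + δ ^ 2 := by
        rw [empMean_add, empMean_const_mul]
    _ ≤ _ := by
        gcongr
        exact empMean_const_le n (by positivity)

/-- Consistency of least squares for the regression function `F`, when it is only fitted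
through approximations `fhat n ω i` of `F (Z i ω)` that are uniformly close on `Θ`. -/
lemma tendsto_leastSquares [IsProbabilityMeasure P] [MetricSpace E]
    [TopologicalSpace.SeparableSpace E] (hZ : IsSample P ρ Z) (hΘ : IsCompact Θ) {θ₀ : E}
    (hθ₀ : θ₀ ∈ Θ) {y : 𝓩 → ℝ} {F : 𝓩 → E → ℝ}
    (hint : ∀ θ ∈ Θ, Integrable (fun p => (y p - F p θ) ^ 2) ρ)
    (hcont : ∀ᵐ p ∂ρ, ContinuousOn (F p) Θ)
    (hmin : ∀ θ ∈ Θ, θ ≠ θ₀ → ∫ p, (y p - F p θ₀) ^ 2 ∂ρ < ∫ p, (y p - F p θ) ^ 2 ∂ρ)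
    {fhat : ℕ → S → ℕ → E → ℝ} {δ : ℕ × S → ℝ} (hδ : Tendsto δ (probFilter P) (𝓝 0))
    (hfhat : ∀ᶠ p in probFilter P, ∀ i, ∀ θ ∈ Θ,
      |fhat p.1 p.2 i θ - F (Z i p.2) θ| ≤ δ p)
    {θhat : ℕ → S → E} (hmem : ∀ᶠ p in probFilter P, θhat p.1 p.2 ∈ Θ)
    (hθhat : ∀ᶠ p in probFilter P,
      empMean p.1 (fun i => (y (Z i p.2) - fhat p.1 p.2 i (θhat p.1 p.2)) ^ 2) ≤
        empMean p.1 (fun i => (y (Z i p.2) - fhat p.1 p.2 i θ₀) ^ 2)) :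
    Tendsto (fun p : ℕ × S => θhat p.1 p.2) (probFilter P) (𝓝 θ₀) := by
  rw [Metric.tendsto_nhds]
  intro ε hε
  set m : E → 𝓩 → ℝ := fun θ p => (y p - F p θ) ^ 2 with hm
  have hball : ∀ θ ∈ Θ \ Metric.ball θ₀ ε, ∃ r > 0, ∃ g : 𝓩 → ℝ, Integrable g ρ ∧
      ∫ p, m θ₀ p ∂ρ < ∫ p, g p ∂ρ ∧ ∀ᵐ p ∂ρ, ∀ θ' ∈ Θ ∩ Metric.ball θ r, g p ≤ m θ' p := by
    intro θ hθ
    refine exists_ball_integral_lt (fun _ _ => sq_nonneg _) hint ?_ hθ.1 (hmin θ hθ.1 ?_)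
    · filter_upwards [hcont] with p hp
      exact (continuousOn_const.sub hp).pow 2
    · rintro rfl
      exact hθ.2 (Metric.mem_ball_self hε)
  choose! r hr g hg hlt hle using hball
  obtain ⟨t, ht, hcover⟩ := (hΘ.diff Metric.isOpen_ball).elim_nhds_subcover
    (fun θ => Metric.ball θ (r θ)) (fun θ hθ => Metric.ball_mem_nhds θ (hr θ hθ))
  set A : ℕ × S → ℝ := fun p => empMean p.1 fun i => m θ₀ (Z i p.2) with hA
  have hAlim : Tendsto A (probFilter P) (𝓝 (∫ p, m θ₀ p ∂ρ)) := hZ.tendsto_empMean (hint θ₀ hθ₀)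
  have hbound : Tendsto (fun p => (1 + δ p) * ((1 + δ p) * A p + (δ p + δ p ^ 2)) +
      (δ p + δ p ^ 2)) (probFilter P) (𝓝 (∫ p, m θ₀ p ∂ρ)) := by
    have h1 : Tendsto (fun p => 1 + δ p) (probFilter P) (𝓝 (1 + 0)) := hδ.const_add 1
    have h2 : Tendsto (fun p => δ p + δ p ^ 2) (probFilter P) (𝓝 (0 + 0 ^ 2)) := hδ.add (hδ.pow 2)
    simpa using (h1.mul ((h1.mul hAlim).add h2)).add h2
  have hsep : ∀ᶠ p in probFilter P, ∀ θ ∈ t,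
      (1 + δ p) * ((1 + δ p) * A p + (δ p + δ p ^ 2)) + (δ p + δ p ^ 2) <
        empMean p.1 fun i => g θ (Z i p.2) :=
    (eventually_all_finset t).2 fun θ hθ =>
      hbound.eventually_lt (hZ.tendsto_empMean (hg θ (ht θ hθ))) (hlt θ (ht θ hθ))
  have hlow : ∀ᶠ p in probFilter P, ∀ θ ∈ t, ∀ i, ∀ θ' ∈ Θ ∩ Metric.ball θ (r θ),
      g θ (Z i p.2) ≤ m θ' (Z i p.2) :=
    (eventually_all_finset t).2 fun θ hθ => eventually_probFilter_of_ae <| by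
      filter_upwards [hZ.ae (hle θ (ht θ hθ))] with ω hω _ using hω
  filter_upwards [hsep, hlow, hfhat, hmem, hθhat] with p h1 h2 h3 h4 h5
  by_contra hfar
  obtain ⟨θ, hθt, hθ⟩ : ∃ θ ∈ t, θhat p.1 p.2 ∈ Metric.ball θ (r θ) := by
    simpa using hcover ⟨h4, hfar⟩
  have hδ0 : 0 ≤ δ p := (abs_nonneg _).trans (h3 0 θ₀ hθ₀)
  refine absurd (h1 θ hθt) (not_lt.2 ?_)
  calc empMean p.1 (fun i => g θ (Z i p.2))
      ≤ empMean p.1 (fun i => (y (Z i p.2) - F (Z i p.2) (θhat p.1 p.2)) ^ 2) :=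
        empMean_mono fun i => h2 θ hθt i _ ⟨h4, hθ⟩
    _ ≤ (1 + δ p) * empMean p.1 (fun i => (y (Z i p.2) - fhat p.1 p.2 i (θhat p.1 p.2)) ^ 2) +
        (δ p + δ p ^ 2) := empMean_sq_le fun i => h3 i _ h4
    _ ≤ (1 + δ p) * ((1 + δ p) * A p + (δ p + δ p ^ 2)) + (δ p + δ p ^ 2) := by
        gcongr
        exact h5.trans (empMean_sq_le fun i => by rw [abs_sub_comm]; exact h3 i _ hθ₀)

end Consistency

/-! ### The estimating equation and the asymptotic expansion -/

section ScoreExpansion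

variable {E : Type*} [NormedAddCommGroup E] [NormedSpace ℝ E]

/-- Expansion of one summand of the estimating equation around `θ₀`, in the direction `v`. The
summand is evaluated with approximations `a` and `g` of the value and of the derivative of `f`. -/
lemma abs_score_sub_le {f : E → ℝ} {θ₀ h v : E} {r ℓ M y a δ δ' : ℝ} {g : E →L[ℝ] ℝ}
    (hf : IsC2LipAt f θ₀ r ℓ) (hℓ : 0 ≤ ℓ) (hℓM : ℓ ≤ M) (hD : ‖fderiv ℝ f θ₀‖ ≤ M)
    (hH : ‖fderiv ℝ (fderiv ℝ f) θ₀‖ ≤ M) (hhr : ‖h‖ < r) (hh1 : ‖h‖ ≤ 1) (hv : ‖v‖ ≤ 1)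
    (ha : |a - f (θ₀ + h)| ≤ δ) (hg : ‖g - fderiv ℝ f (θ₀ + h)‖ ≤ δ') :
    |(y - a) * g v - ((y - f θ₀) * fderiv ℝ f θ₀ v +
        (y - f θ₀) * fderiv ℝ (fderiv ℝ f) θ₀ h v - fderiv ℝ f θ₀ h * fderiv ℝ f θ₀ v)| ≤
      (|y - f θ₀| * M + 8 * M ^ 2) * ‖h‖ ^ 2 +
        ((|y - f θ₀| + 3 * M) * δ' + δ * (3 * M + δ')) := by
  have hM : 0 ≤ M := hℓ.trans hℓM
  have hh0 := norm_nonneg h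
  have hh2 : ‖h‖ ^ 2 ≤ ‖h‖ := by nlinarith
  have app : ∀ (T : E →L[ℝ] ℝ) {c : ℝ}, ‖T‖ ≤ c → |T v| ≤ c := fun T c hT => by
    have := T.le_opNorm v
    calc |T v| ≤ ‖T‖ * ‖v‖ := this
      _ ≤ c * 1 := mul_le_mul hT hv (norm_nonneg _) ((norm_nonneg _).trans hT)
      _ = c := mul_one c
  set u := y - f θ₀ with hu
  set D := fderiv ℝ f θ₀ with hDdef
  set H := fderiv ℝ (fderiv ℝ f) θ₀ with hHdef
  set D₁ := fderiv ℝ f (θ₀ + h) with hD₁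
  have hDh : |D h| ≤ M * ‖h‖ := (D.le_opNorm h).trans (by gcongr)
  have hHh : ‖H h‖ ≤ M * ‖h‖ := (H.le_opNorm h).trans (by gcongr)
  have hHhh : |H h h| ≤ M * ‖h‖ ^ 2 := by
    calc |H h h| ≤ ‖H h‖ * ‖h‖ := (H h).le_opNorm h
      _ ≤ M * ‖h‖ * ‖h‖ := by gcongr
      _ = _ := by ring
  -- `s` and `w` are the remainders of the derivative and of the value
  obtain ⟨s, hs⟩ : ∃ s, s = D₁ v - D v - H h v := ⟨_, rfl⟩
  obtain ⟨w, hw⟩ : ∃ w, w = f (θ₀ + h) - f θ₀ - D h := ⟨_, rfl⟩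
  have hsb : |s| ≤ M * ‖h‖ ^ 2 := by
    have := app (D₁ - D - H h) (hf.norm_fderiv_sub_le hℓ hhr)
    rw [hs]
    exact this.trans (by gcongr)
  have hwb : |w| ≤ 2 * M * ‖h‖ ^ 2 := by
    have h1 := hf.abs_sub_le hℓ hhr
    have h2 : ℓ * ‖h‖ ^ 3 ≤ M * ‖h‖ ^ 2 := by
      have : ‖h‖ ^ 3 ≤ ‖h‖ ^ 2 := pow_le_pow_of_le_one hh0 hh1 (by norm_num)
      gcongr
    calc |w| = |(w - 2⁻¹ * H h h) + 2⁻¹ * H h h| := by rw [sub_add_cancel]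
      _ ≤ |w - 2⁻¹ * H h h| + |2⁻¹ * H h h| := abs_add_le _ _
      _ ≤ M * ‖h‖ ^ 2 + M * ‖h‖ ^ 2 := by
          refine add_le_add ?_ ?_
          · rw [hw]; exact h1.trans h2
          · rw [abs_mul, abs_of_pos (by norm_num : (0 : ℝ) < 2⁻¹)]
            nlinarith [abs_nonneg (H h h)]
      _ = _ := by ring
  have hDv : |D v| ≤ M := app D hD
  have hHv : |H h v| ≤ M * ‖h‖ := app (H h) hHh
  have hD₁v : |D₁ v| ≤ 3 * M := by
    have : D₁ v = D v + H h v + s := by rw [hs]; ring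
    rw [this]
    calc _ ≤ |D v| + |H h v| + |s| := abs_add_three _ _ _
      _ ≤ M + M * ‖h‖ + M * ‖h‖ ^ 2 := by gcongr
      _ ≤ 3 * M := by nlinarith
  have hsum : |H h v + s| ≤ 2 * M * ‖h‖ := by
    calc _ ≤ |H h v| + |s| := abs_add_le _ _
      _ ≤ M * ‖h‖ + M * ‖h‖ ^ 2 := by gcongr
      _ ≤ 2 * M * ‖h‖ := by nlinarith
  have hres : |y - f (θ₀ + h)| ≤ |u| + 3 * M := by
    have : y - f (θ₀ + h) = u - D h - w := by rw [hw, hu]; ring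
    rw [this]
    calc _ ≤ |u - D h| + |w| := abs_sub _ _
      _ ≤ |u| + |D h| + |w| := by gcongr; exact abs_sub _ _
      _ ≤ |u| + M * ‖h‖ + 2 * M * ‖h‖ ^ 2 := by gcongr
      _ ≤ _ := by nlinarith
  have hgv : |g v - D₁ v| ≤ δ' := app (g - D₁) hg
  have hδ : 0 ≤ δ := (abs_nonneg _).trans ha
  have hgv' : |g v| ≤ 3 * M + δ' := by
    calc |g v| = |D₁ v + (g v - D₁ v)| := by rw [add_sub_cancel]
      _ ≤ _ := (abs_add_le _ _).trans (add_le_add hD₁v hgv)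
  have hid : (y - a) * g v - (u * D v + u * H h v - D h * D v) =
      (u * s - D h * (H h v + s) - w * D₁ v) +
        ((y - f (θ₀ + h)) * (g v - D₁ v) - (a - f (θ₀ + h)) * g v) := by
    rw [hw, hs, hu]; ring
  rw [hid]
  refine (abs_add_le _ _).trans (add_le_add ?_ ?_)
  · calc _ ≤ |u * s| + |D h * (H h v + s)| + |w * D₁ v| :=
          (abs_sub _ _).trans (add_le_add (abs_sub _ _) le_rfl)
      _ ≤ |u| * (M * ‖h‖ ^ 2) + (M * ‖h‖) * (2 * M * ‖h‖) + (2 * M * ‖h‖ ^ 2) * (3 * M) := by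
          rw [abs_mul, abs_mul, abs_mul]
          gcongr
      _ = _ := by ring
  · calc _ ≤ |(y - f (θ₀ + h)) * (g v - D₁ v)| + |(a - f (θ₀ + h)) * g v| := abs_sub _ _
      _ ≤ _ := by
          rw [abs_mul, abs_mul]
          gcongr

end ScoreExpansion

section Expansion

variable {S 𝓩 : Type*} [MeasurableSpace S] [MeasurableSpace 𝓩] {P : Measure S}
  {ρ : Measure 𝓩} {Z : ℕ → S → 𝓩} {q : ℕ}

lemma norm_le_sum_abs (v : EuclideanSpace ℝ (Fin q)) : ‖v‖ ≤ ∑ j, |v j| := by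
  calc ‖v‖ = ‖∑ j, v j • EuclideanSpace.single j (1 : ℝ)‖ := by
        congr 1
        have := (EuclideanSpace.basisFun (Fin q) ℝ).sum_repr v
        simpa using this.symm
    _ ≤ ∑ j, ‖v j • EuclideanSpace.single j (1 : ℝ)‖ := norm_sum_le _ _
    _ = _ := by simp [norm_smul]

lemma clm_apply_eq_sum {F : Type*} [NormedAddCommGroup F] [NormedSpace ℝ F]
    (T : EuclideanSpace ℝ (Fin q) →L[ℝ] F) (v : EuclideanSpace ℝ (Fin q)) :
    T v = ∑ k, v k • T (EuclideanSpace.single k 1) := by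
  have := (EuclideanSpace.basisFun (Fin q) ℝ).sum_repr v
  conv_lhs => rw [← this]
  simp

lemma norm_clm_le_sum {F : Type*} [NormedAddCommGroup F] [NormedSpace ℝ F]
    (T : EuclideanSpace ℝ (Fin q) →L[ℝ] F) :
    ‖T‖ ≤ ∑ k, ‖T (EuclideanSpace.single k 1)‖ := by
  refine T.opNorm_le_bound (Finset.sum_nonneg fun _ _ => norm_nonneg _) fun v => ?_
  rw [clm_apply_eq_sum T v, Finset.sum_mul]
  refine (norm_sum_le _ _).trans (Finset.sum_le_sum fun k _ => ?_)
  rw [norm_smul, mul_comm]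
  gcongr
  exact PiLp.norm_apply_le v k

/-- The averaged estimating equation: if the approximate scores sum to zero at `θ₀ + d`, then
`s + V d` is small, where `s` is the mean of the scores at `θ₀` and `V` the limit of the mean
Hessian matrices. -/
lemma abs_mean_score_add_le {n : ℕ} {f : ℕ → EuclideanSpace ℝ (Fin q) → ℝ}
    {θ₀ d : EuclideanSpace ℝ (Fin q)} {r δ δ' : ℝ} {ℓ M y a : ℕ → ℝ}
    {g : ℕ → EuclideanSpace ℝ (Fin q) →L[ℝ] ℝ}
    (hf : ∀ i, IsC2LipAt (f i) θ₀ r (ℓ i)) (hℓ : ∀ i, 0 ≤ ℓ i) (hℓM : ∀ i, ℓ i ≤ M i)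
    (hD : ∀ i, ‖fderiv ℝ (f i) θ₀‖ ≤ M i) (hH : ∀ i, ‖fderiv ℝ (fderiv ℝ (f i)) θ₀‖ ≤ M i)
    (hdr : ‖d‖ < r) (hd1 : ‖d‖ ≤ 1)
    (ha : ∀ i, |a i - f i (θ₀ + d)| ≤ δ) (hg : ∀ i, ‖g i - fderiv ℝ (f i) (θ₀ + d)‖ ≤ δ')
    (j : Fin q) (V : Fin q → ℝ)
    (hzero : empMean n (fun i => (y i - a i) * g i (EuclideanSpace.single j 1)) = 0) :
    |empMean n (fun i => -2 * ((y i - f i θ₀) * fderiv ℝ (f i) θ₀ (EuclideanSpace.single j 1))) +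
        ∑ k, V k * d k| ≤
      (∑ k, |empMean n (fun i => 2 * (fderiv ℝ (f i) θ₀ (EuclideanSpace.single k 1) *
          fderiv ℝ (f i) θ₀ (EuclideanSpace.single j 1) - (y i - f i θ₀) *
          fderiv ℝ (fderiv ℝ (f i)) θ₀ (EuclideanSpace.single k 1) (EuclideanSpace.single j 1))) -
          V k| +
        2 * empMean n (fun i => |y i - f i θ₀| * M i + 8 * M i ^ 2) * ‖d‖) * ‖d‖ +
      2 * ((empMean n (fun i => |y i - f i θ₀|) + 3 * empMean n M) * δ' +
        δ * (3 * empMean n M + δ')) := by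
  set b : Fin q → EuclideanSpace ℝ (Fin q) := fun k => EuclideanSpace.single k 1 with hb
  set A : Fin q → ℝ := fun k => empMean n (fun i => 2 * (fderiv ℝ (f i) θ₀ (b k) *
    fderiv ℝ (f i) θ₀ (b j) - (y i - f i θ₀) * fderiv ℝ (fderiv ℝ (f i)) θ₀ (b k) (b j))) with hA
  have hδ : 0 ≤ δ := (abs_nonneg _).trans (ha 0)
  have hδ' : 0 ≤ δ' := (norm_nonneg _).trans (hg 0)
  -- the linear part
  have hlin : empMean n (fun i => -2 * ((y i - f i θ₀) * fderiv ℝ (f i) θ₀ (b j))) +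
      ∑ k, A k * d k = 2 * empMean n (fun i => (y i - a i) * g i (b j) -
        ((y i - f i θ₀) * fderiv ℝ (f i) θ₀ (b j) +
          (y i - f i θ₀) * fderiv ℝ (fderiv ℝ (f i)) θ₀ d (b j) -
            fderiv ℝ (f i) θ₀ d * fderiv ℝ (f i) θ₀ (b j))) := by
    have h1 : ∑ k, A k * d k = empMean n fun i => ∑ k, d k * (2 * (fderiv ℝ (f i) θ₀ (b k) *
        fderiv ℝ (f i) θ₀ (b j) - (y i - f i θ₀) *
          fderiv ℝ (fderiv ℝ (f i)) θ₀ (b k) (b j))) := by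
      rw [empMean_sum]
      exact Finset.sum_congr rfl fun k _ => by rw [empMean_const_mul, mul_comm]
    have h2 : ∀ i, ∑ k, d k * (2 * (fderiv ℝ (f i) θ₀ (b k) * fderiv ℝ (f i) θ₀ (b j) -
        (y i - f i θ₀) * fderiv ℝ (fderiv ℝ (f i)) θ₀ (b k) (b j))) =
        2 * (fderiv ℝ (f i) θ₀ d * fderiv ℝ (f i) θ₀ (b j) -
          (y i - f i θ₀) * fderiv ℝ (fderiv ℝ (f i)) θ₀ d (b j)) := fun i => by
      rw [clm_apply_eq_sum (fderiv ℝ (f i) θ₀) d,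
        clm_apply_eq_sum (fderiv ℝ (fderiv ℝ (f i)) θ₀) d]
      simp only [sum_apply, smul_apply, smul_eq_mul, Finset.sum_mul,
        Finset.mul_sum, ← Finset.sum_sub_distrib]
      exact Finset.sum_congr rfl fun k _ => by ring
    calc _ = empMean n (fun i => 2 * ((y i - a i) * g i (b j) -
        ((y i - f i θ₀) * fderiv ℝ (f i) θ₀ (b j) +
          (y i - f i θ₀) * fderiv ℝ (fderiv ℝ (f i)) θ₀ d (b j) -
            fderiv ℝ (f i) θ₀ d * fderiv ℝ (f i) θ₀ (b j))) +
          -2 * ((y i - a i) * g i (b j))) := by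
          rw [h1, ← empMean_add]
          congr 1
          funext i
          rw [h2]
          ring
      _ = _ := by rw [empMean_add, empMean_const_mul, empMean_const_mul, hzero]; ring
  have hrem : |empMean n (fun i => (y i - a i) * g i (b j) -
        ((y i - f i θ₀) * fderiv ℝ (f i) θ₀ (b j) +
          (y i - f i θ₀) * fderiv ℝ (fderiv ℝ (f i)) θ₀ d (b j) -
            fderiv ℝ (f i) θ₀ d * fderiv ℝ (f i) θ₀ (b j)))| ≤
      empMean n (fun i => |y i - f i θ₀| * M i + 8 * M i ^ 2) * ‖d‖ ^ 2 +
        ((empMean n (fun i => |y i - f i θ₀|) + 3 * empMean n M) * δ' +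
        δ * (3 * empMean n M + δ')) := by
    refine (abs_empMean_le _ _).trans ?_
    refine (empMean_mono fun i => abs_score_sub_le (hf i) (hℓ i) (hℓM i) (hD i) (hH i) hdr hd1
      (by simp [hb]) (ha i) (hg i)).trans ?_
    have h3 : ∀ i, (|y i - f i θ₀| * M i + 8 * M i ^ 2) * ‖d‖ ^ 2 +
        ((|y i - f i θ₀| + 3 * M i) * δ' + δ * (3 * M i + δ')) =
        ‖d‖ ^ 2 * (|y i - f i θ₀| * M i + 8 * M i ^ 2) + (δ' * |y i - f i θ₀| +
          (3 * δ' + 3 * δ) * M i + δ * δ') := fun i => by ring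
    simp_rw [h3]
    rw [empMean_add, empMean_add, empMean_add, empMean_const_mul, empMean_const_mul,
      empMean_const_mul]
    have := empMean_const_le n (mul_nonneg hδ hδ')
    linarith
  have hsplit : ∑ k, V k * d k = ∑ k, A k * d k - ∑ k, (A k - V k) * d k := by
    rw [← Finset.sum_sub_distrib]
    exact Finset.sum_congr rfl fun k _ => by ring
  have hdev : |∑ k, (A k - V k) * d k| ≤ (∑ k, |A k - V k|) * ‖d‖ := by
    rw [Finset.sum_mul]
    refine (Finset.abs_sum_le_sum_abs _ _).trans (Finset.sum_le_sum fun k _ => ?_)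
    rw [abs_mul]
    gcongr
    exact PiLp.norm_apply_le d k
  rw [hsplit, ← add_sub_assoc, hlin]
  refine (abs_sub _ _).trans ?_
  rw [abs_mul, abs_two]
  nlinarith

/-- Asymptotic expansion of an estimator `θhat` that is consistent and solves an approximate
estimating equation, the approximation error being `o_p(n^{-1/2})` uniformly. -/
lemma tendsto_expansion [IsProbabilityMeasure P] (hZ : IsSample P ρ Z)
    {θ₀ : EuclideanSpace ℝ (Fin q)} {y : 𝓩 → ℝ} {F : 𝓩 → EuclideanSpace ℝ (Fin q) → ℝ} {r : ℝ}
    (hr : 0 < r) {L M : 𝓩 → ℝ} (hF : ∀ᵐ p ∂ρ, IsC2LipAt (F p) θ₀ r (L p))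
    (hL0 : ∀ p, 0 ≤ L p) (hLM : ∀ p, L p ≤ M p) (hDM : ∀ p, ‖fderiv ℝ (F p) θ₀‖ ≤ M p)
    (hHM : ∀ p, ‖fderiv ℝ (fderiv ℝ (F p)) θ₀‖ ≤ M p) (hM : MemLp M 2 ρ)
    (hu : MemLp (fun p => y p - F p θ₀) 2 ρ)
    (hD : ∀ v, MemLp (fun p => fderiv ℝ (F p) θ₀ v) 2 ρ)
    (hH : ∀ v w, MemLp (fun p => fderiv ℝ (fderiv ℝ (F p)) θ₀ v w) 2 ρ)
    {V : Matrix (Fin q) (Fin q) ℝ} (hV : IsUnit V)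
    (hVeq : ∀ j k, V j k = ∫ p, 2 * (fderiv ℝ (F p) θ₀ (EuclideanSpace.single k 1) *
      fderiv ℝ (F p) θ₀ (EuclideanSpace.single j 1) - (y p - F p θ₀) *
      fderiv ℝ (fderiv ℝ (F p)) θ₀ (EuclideanSpace.single k 1)
        (EuclideanSpace.single j 1)) ∂ρ)
    {s : 𝓩 → EuclideanSpace ℝ (Fin q)}
    (hs : ∀ p j, s p j = -2 * ((y p - F p θ₀) * fderiv ℝ (F p) θ₀ (EuclideanSpace.single j 1)))
    (hsL : MemLp s 2 ρ) (hs0 : ∀ j, ∫ p, s p j ∂ρ = 0)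
    {θhat : ℕ → S → EuclideanSpace ℝ (Fin q)}
    (hcons : Tendsto (fun p : ℕ × S => θhat p.1 p.2) (probFilter P) (𝓝 θ₀))
    {a : ℕ → S → ℕ → ℝ} {g : ℕ → S → ℕ → EuclideanSpace ℝ (Fin q) →L[ℝ] ℝ}
    {δ δ' : ℕ × S → ℝ}
    (hδ : Tendsto (fun p : ℕ × S => √(p.1 : ℝ) * δ p) (probFilter P) (𝓝 0))
    (hδ' : Tendsto (fun p : ℕ × S => √(p.1 : ℝ) * δ' p) (probFilter P) (𝓝 0))
    (hδ'0 : Tendsto δ' (probFilter P) (𝓝 0))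
    (ha : ∀ᶠ p in probFilter P, ∀ i,
      |a p.1 p.2 i - F (Z i p.2) (θhat p.1 p.2)| ≤ δ p)
    (hg : ∀ᶠ p in probFilter P, ∀ i,
      ‖g p.1 p.2 i - fderiv ℝ (F (Z i p.2)) (θhat p.1 p.2)‖ ≤ δ' p)
    (hzero : ∀ᶠ p in probFilter P, ∀ j, empMean p.1 (fun i =>
      (y (Z i p.2) - a p.1 p.2 i) * g p.1 p.2 i (EuclideanSpace.single j 1)) = 0) :
    IsLittleOpInvSqrt P (fun n ω => ‖(θhat n ω - θ₀) - (-(V⁻¹.toEuclideanLin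
        ((1 / (n : ℝ)) • ∑ i ∈ Finset.range n, s (Z i ω))))‖ₑ) := by
  set b : Fin q → EuclideanSpace ℝ (Fin q) := fun k => EuclideanSpace.single k 1 with hb
  set U : 𝓩 → ℝ := fun p => |y p - F p θ₀| with hU
  have hUL : MemLp U 2 ρ := hu.abs
  have hρ : IsProbabilityMeasure ρ := by
    rw [← hZ.map_eq 0]; exact Measure.isProbabilityMeasure_map (hZ.measurable 0).aemeasurable
  set W : Fin q → Fin q → 𝓩 → ℝ := fun j k p => 2 * (fderiv ℝ (F p) θ₀ (b k) *
      fderiv ℝ (F p) θ₀ (b j) - (y p - F p θ₀) *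
      fderiv ℝ (fderiv ℝ (F p)) θ₀ (b k) (b j)) with hW
  have hWint : ∀ j k, Integrable (W j k) ρ := fun j k =>
    (((hD (b k)).integrable_mul (hD (b j))).sub (hu.integrable_mul (hH (b k) (b j)))).const_mul 2
  -- the laws of large numbers
  have hWlim : ∀ j k, Tendsto (fun p : ℕ × S =>
      |empMean p.1 (fun i => W j k (Z i p.2)) - V j k|) (probFilter P) (𝓝 0) := fun j k => by
    have := (hZ.tendsto_empMean (hWint j k)).sub_const (V j k)
    rw [hVeq j k, sub_self] at this
    simpa [hVeq j k] using this.abs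
  have hMlim := hZ.tendsto_empMean (hM.integrable (by norm_num))
  have hUlim := hZ.tendsto_empMean (hUL.integrable (by norm_num))
  have hGlim := hZ.tendsto_empMean
    (f := fun p => U p * M p + 8 * M p ^ 2)
    ((hUL.integrable_mul hM).add (hM.integrable_sq.const_mul 8))
  have hd : Tendsto (fun p : ℕ × S => ‖θhat p.1 p.2 - θ₀‖) (probFilter P) (𝓝 0) := by
    rw [← tendsto_iff_norm_sub_tendsto_zero]
    exact hcons
  -- `‖s + V d‖ ≤ α ‖d‖ + β` with `α = o_p(1)` and `β = o_p(n^{-1/2})`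
  set α : ℕ × S → ℝ := fun p => ∑ j, (∑ k, |empMean p.1 (fun i => W j k (Z i p.2)) - V j k| +
      2 * empMean p.1 (fun i => U (Z i p.2) * M (Z i p.2) + 8 * M (Z i p.2) ^ 2) *
        ‖θhat p.1 p.2 - θ₀‖) with hα
  set β : ℕ × S → ℝ := fun p => ∑ _j : Fin q, 2 * ((empMean p.1 (fun i => U (Z i p.2)) +
      3 * empMean p.1 (fun i => M (Z i p.2))) * δ' p +
        δ p * (3 * empMean p.1 (fun i => M (Z i p.2)) + δ' p)) with hβ
  have hαlim : Tendsto α (probFilter P) (𝓝 0) := by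
    rw [← Finset.sum_const_zero (s := (Finset.univ : Finset (Fin q)))]
    refine tendsto_finsetSum _ fun j _ => ?_
    have h1 : Tendsto (fun p : ℕ × S =>
        ∑ k, |empMean p.1 (fun i => W j k (Z i p.2)) - V j k|) (probFilter P) (𝓝 0) := by
      rw [← Finset.sum_const_zero (s := (Finset.univ : Finset (Fin q)))]
      exact tendsto_finsetSum _ fun k _ => hWlim j k
    simpa using h1.add ((hGlim.const_mul 2).mul hd)
  have hβlim : Tendsto (fun p : ℕ × S => √(p.1 : ℝ) * β p) (probFilter P) (𝓝 0) := by
    have h1 := (((hUlim.add (hMlim.const_mul 3)).mul hδ').add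
      (hδ.mul ((hMlim.const_mul 3).add hδ'0))).const_mul 2
    have h2 := tendsto_finsetSum (Finset.univ : Finset (Fin q)) fun _ _ => h1
    simp only [mul_zero, zero_mul, add_zero, Finset.sum_const_zero] at h2
    refine h2.congr fun p => ?_
    simp only [hβ, Finset.mul_sum]
    exact Finset.sum_congr rfl fun _ _ => by ring
  set T : EuclideanSpace ℝ (Fin q) →L[ℝ] EuclideanSpace ℝ (Fin q) :=
    V⁻¹.toEuclideanLin.toContinuousLinearMap with hT
  have hTV : ∀ v, T (V.toEuclideanLin v) = v := fun v => by
    have hdet : IsUnit V.det := (Matrix.isUnit_iff_isUnit_det _).1 hV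
    simp [hT, Matrix.toLpLin_apply, Matrix.mulVec_mulVec, Matrix.nonsing_inv_mul _ hdet]
  set c := ‖T‖ with hc
  have hc0 : 0 ≤ c := norm_nonneg T
  set sbar : ℕ × S → EuclideanSpace ℝ (Fin q) := fun p =>
    (1 / (p.1 : ℝ)) • ∑ i ∈ Finset.range p.1, s (Z i p.2) with hsbar
  set X : ℕ → S → EuclideanSpace ℝ (Fin q) := fun n ω =>
    (√(n : ℝ))⁻¹ • ∑ i ∈ Finset.range n, s (Z i ω) with hX
  have hXlim := hZ.tendstoInDistribution hsL hs0 (C := Matrix.of fun j k => ∫ p, s p j * s p k ∂ρ)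
    fun _ _ => rfl
  have hsX : ∀ p : ℕ × S, √(p.1 : ℝ) * ‖sbar p‖ = ‖X p.1 p.2‖ := fun p => by
    rw [hsbar, hX, norm_smul, norm_smul, ← mul_assoc, Real.norm_of_nonneg (by positivity),
      Real.norm_of_nonneg (by positivity)]
    congr 1
    rcases Nat.eq_zero_or_pos p.1 with h | h
    · simp [h]
    · have : (0 : ℝ) < p.1 := by exact_mod_cast h
      field_simp
      rw [Real.sq_sqrt this.le]
  have hmain : ∀ᶠ p in probFilter P,
      ‖sbar p + V.toEuclideanLin (θhat p.1 p.2 - θ₀)‖ ≤ α p * ‖θhat p.1 p.2 - θ₀‖ + β p := by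
    have hFs : ∀ᶠ p in probFilter P, ∀ i, IsC2LipAt (F (Z i p.2)) θ₀ r (L (Z i p.2)) :=
      eventually_probFilter_of_ae (by filter_upwards [hZ.ae hF] with ω hω _ using hω)
    filter_upwards [hFs, ha, hg, hzero, hd.eventually_lt_const hr,
      hd.eventually_le_const one_pos] with p h1 h2 h3 h4 h5 h6
    refine (norm_le_sum_abs _).trans ?_
    rw [hα, hβ, Finset.sum_mul, ← Finset.sum_add_distrib]
    refine Finset.sum_le_sum fun j _ => ?_
    have := abs_mean_score_add_le (n := p.1) (y := fun i => y (Z i p.2)) (V := V j) h1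
      (fun i => hL0 _) (fun i => hLM _) (fun i => hDM _) (fun i => hHM _) h5 h6
      (by simpa using h2) (by simpa using h3) j (h4 j)
    refine le_trans (le_of_eq ?_) this
    congr 1
    simp only [hsbar, PiLp.add_apply, PiLp.smul_apply, WithLp.ofLp_sum, Finset.sum_apply, hs,
      smul_eq_mul, empMean]
    congr 1
  -- the quantity of interest
  set t : ℕ × S → ℝ := fun p => ‖(θhat p.1 p.2 - θ₀) - (-(V⁻¹.toEuclideanLin (sbar p)))‖ with ht
  have hbound : ∀ᶠ p in probFilter P,
      √(p.1 : ℝ) * t p ≤ 2 * c ^ 2 * (α p * ‖X p.1 p.2‖) + 2 * c * (√(p.1 : ℝ) * β p) := by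
    have hsmall : ∀ᶠ p in probFilter P, c * α p ≤ 1 / 2 := by
      have := hαlim.const_mul c
      rw [mul_zero] at this
      exact this.eventually_le_const (by norm_num)
    have hα0 : ∀ p, 0 ≤ α p := fun p => by
      have hM0 : ∀ z, 0 ≤ M z := fun z => (hL0 z).trans (hLM z)
      have : 0 ≤ empMean p.1 (fun i => U (Z i p.2) * M (Z i p.2) + 8 * M (Z i p.2) ^ 2) := by
        refine mul_nonneg (by positivity) (Finset.sum_nonneg fun i _ => ?_)
        have := mul_nonneg (abs_nonneg (y (Z i p.2) - F (Z i p.2) θ₀)) (hM0 (Z i p.2))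
        positivity
      positivity
    filter_upwards [hmain, hsmall] with p h1 h2
    set d := θhat p.1 p.2 - θ₀ with hdd
    have h3 : t p ≤ c * (α p * ‖d‖ + β p) := by
      have : d - (-(V⁻¹.toEuclideanLin (sbar p))) = T (sbar p + V.toEuclideanLin d) := by
        rw [map_add, hTV, sub_neg_eq_add, add_comm]
        rfl
      rw [ht]
      simp only
      rw [← hdd, this]
      exact (T.le_opNorm _).trans (by gcongr)
    have h4 : ‖d‖ ≤ t p + c * ‖sbar p‖ := by
      calc ‖d‖ = ‖(d - (-(V⁻¹.toEuclideanLin (sbar p)))) - T (sbar p)‖ := by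
            congr 1
            rw [sub_neg_eq_add]
            exact (add_sub_cancel_right _ _).symm
        _ ≤ _ := (norm_sub_le _ _).trans (add_le_add le_rfl (T.le_opNorm _))
    have ht0 : 0 ≤ t p := norm_nonneg _
    have h5 : t p ≤ 2 * c ^ 2 * α p * ‖sbar p‖ + 2 * c * β p := by
      have h6 : c * α p * ‖d‖ ≤ c * α p * (t p + c * ‖sbar p‖) :=
        mul_le_mul_of_nonneg_left h4 (mul_nonneg hc0 (hα0 p))
      have h7 : c * α p * t p ≤ 1 / 2 * t p := mul_le_mul_of_nonneg_right h2 ht0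
      nlinarith
    calc √(p.1 : ℝ) * t p ≤ √(p.1 : ℝ) * (2 * c ^ 2 * α p * ‖sbar p‖ + 2 * c * β p) := by gcongr
      _ = 2 * c ^ 2 * (α p * (√(p.1 : ℝ) * ‖sbar p‖)) + 2 * c * (√(p.1 : ℝ) * β p) := by ring
      _ = _ := by rw [hsX]
  have hlim : Tendsto (fun p : ℕ × S => √(p.1 : ℝ) * t p) (probFilter P) (𝓝 0) := by
    have h1 := ((tendsto_mul_norm_probFilter hXlim hαlim).const_mul (2 * c ^ 2)).add
      (hβlim.const_mul (2 * c))
    simp only [mul_zero, add_zero] at h1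
    exact squeeze_zero' (Eventually.of_forall fun p => by positivity) hbound h1
  rw [isLittleOpInvSqrt_iff]
  have := ENNReal.tendsto_ofReal hlim
  rw [ENNReal.ofReal_zero] at this
  refine this.congr fun p => ?_
  rw [ENNReal.ofReal_mul (Real.sqrt_nonneg _), ht]
  simp only [ofReal_norm]
  rfl

end Expansion

/-! ### Second moments of the influence functions -/

section Moments

variable {𝓧 : Type*} [MeasurableSpace 𝓧] {μ : Measure 𝓧} {ν : Measure ℝ}

lemma memLp_fst_mul_snd {f : 𝓧 → ℝ} (hf : MemLp f 2 μ) (hν : MemLp id 2 ν) :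
    MemLp (fun p : 𝓧 × ℝ => f p.1 * p.2) 2 (μ.prod ν) := by
  have hm : AEStronglyMeasurable (fun p : 𝓧 × ℝ => f p.1 * p.2) (μ.prod ν) :=
    hf.aestronglyMeasurable.comp_fst.mul hν.aestronglyMeasurable.comp_snd
  rw [memLp_two_iff_integrable_sq hm]
  simpa [mul_pow] using hf.integrable_sq.mul_prod hν.integrable_sq

variable {q : ℕ} {R : 𝓧 → ℝ} {D : 𝓧 → EuclideanSpace ℝ (Fin q)}

/-- The score `-2 (R + e) D` of the residual `R + e`, where `D` is the gradient. -/
def scoreFun (R : 𝓧 → ℝ) (D : 𝓧 → EuclideanSpace ℝ (Fin q)) (p : 𝓧 × ℝ) :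
    EuclideanSpace ℝ (Fin q) :=
  (-2 * (R p.1 + p.2)) • D p.1

/-- The part `2 e D` of the score that is due to the errors. -/
def noiseFun (D : 𝓧 → EuclideanSpace ℝ (Fin q)) (p : 𝓧 × ℝ) : EuclideanSpace ℝ (Fin q) :=
  (2 * p.2) • D p.1

lemma aestronglyMeasurable_scoreFun (hR : MemLp R 2 μ) (hD : MemLp D 2 μ) :
    AEStronglyMeasurable (scoreFun R D) (μ.prod ν) :=
  ((hR.aestronglyMeasurable.comp_fst.add aestronglyMeasurable_id.comp_snd).const_mul _).smul
    hD.aestronglyMeasurable.comp_fst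

lemma memLp_noiseFun (hD : MemLp D 2 μ) (hν : MemLp id 2 ν) :
    MemLp (noiseFun D) 2 (μ.prod ν) := by
  refine MemLp.of_eval_piLp fun j => ?_
  have := (memLp_fst_mul_snd (memLp_coord hD j) hν).const_mul 2
  refine this.ae_eq (ae_of_all _ fun p => ?_)
  simp only [noiseFun, PiLp.smul_apply, smul_eq_mul]
  ring

variable [IsProbabilityMeasure ν]

lemma memLp_of_comp_fst {f : 𝓧 → ℝ} (hfm : AEStronglyMeasurable f μ)
    (hf : MemLp (fun p : 𝓧 × ℝ => f p.1) 2 (μ.prod ν)) : MemLp f 2 μ := by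
  have hfst := measurePreserving_fst (μ := μ) (ν := ν)
  rw [← hfst.map_eq] at hfm ⊢
  exact (memLp_map_measure_iff hfm hfst.aemeasurable).2 hf

/-- The product of residual and gradient is square integrable, as the score is. -/
lemma memLp_residual_smul (hR : MemLp R 2 μ) (hD : MemLp D 2 μ) (hν : MemLp id 2 ν)
    (hs : MemLp (scoreFun R D) 2 (μ.prod ν)) : MemLp (fun z => R z • D z) 2 μ := by
  refine MemLp.of_eval_piLp fun j => ?_
  refine memLp_of_comp_fst (ν := ν)
    ((hR.aestronglyMeasurable.smul hD.aestronglyMeasurable) |> fun h =>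
      (EuclideanSpace.proj (𝕜 := ℝ) j).continuous.comp_aestronglyMeasurable h) ?_
  have h1 := ((memLp_coord hs j).const_mul (-2⁻¹)).sub (memLp_fst_mul_snd (memLp_coord hD j) hν)
  refine h1.ae_eq (ae_of_all _ fun p => ?_)
  simp only [scoreFun, PiLp.smul_apply, smul_eq_mul, Pi.sub_apply]
  ring

variable [IsProbabilityMeasure μ]

lemma integral_fst_eq (f : 𝓧 → ℝ) : ∫ p, f p.1 ∂(μ.prod ν) = ∫ z, f z ∂μ := by
  simp [integral_fun_fst]

lemma integral_fst_mul_snd_eq_zero (hν0 : ∫ t, t ∂ν = 0) (f : 𝓧 → ℝ) :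
    ∫ p, f p.1 * p.2 ∂(μ.prod ν) = 0 := by
  rw [integral_prod_mul f fun t => t, hν0, mul_zero]

/-- The mean square of a residual with an independent centered error splits. -/
lemma integral_add_snd_sq {f : 𝓧 → ℝ} (hf : MemLp f 2 μ) (hν : MemLp id 2 ν)
    (hν0 : ∫ t, t ∂ν = 0) :
    ∫ p, (f p.1 + p.2) ^ 2 ∂(μ.prod ν) = ∫ z, f z ^ 2 ∂μ + ∫ t, t ^ 2 ∂ν := by
  have h1 : Integrable (fun p : 𝓧 × ℝ => f p.1 ^ 2) (μ.prod ν) := hf.integrable_sq.comp_fst ν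
  have h2 : Integrable (fun p : 𝓧 × ℝ => 2 * f p.1 * p.2) (μ.prod ν) :=
    ((hf.integrable (by norm_num)).const_mul 2).mul_prod (hν.integrable (by norm_num))
  have h3 : Integrable (fun p : 𝓧 × ℝ => p.2 ^ 2) (μ.prod ν) := hν.integrable_sq.comp_snd μ
  have h4 : ∀ p : 𝓧 × ℝ, (f p.1 + p.2) ^ 2 = f p.1 ^ 2 + 2 * f p.1 * p.2 + p.2 ^ 2 :=
    fun p => by ring
  have h12 : Integrable (fun p : 𝓧 × ℝ => f p.1 ^ 2 + 2 * f p.1 * p.2) (μ.prod ν) := h1.add h2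
  simp_rw [h4]
  rw [integral_add h12 h3, integral_add h1 h2, integral_fst_eq (fun z => f z ^ 2),
    integral_fst_mul_snd_eq_zero hν0 (fun z => 2 * f z), add_zero,
    integral_fun_snd fun t : ℝ => t ^ 2]
  simp

lemma integral_scoreFun (hR : MemLp R 2 μ) (hD : MemLp D 2 μ) (hν : MemLp id 2 ν)
    (hν0 : ∫ t, t ∂ν = 0) (j : Fin q) :
    ∫ p, scoreFun R D p j ∂(μ.prod ν) = -2 * ∫ z, R z * D z j ∂μ := by
  have h1 : Integrable (fun p : 𝓧 × ℝ => -2 * (R p.1 * D p.1 j)) (μ.prod ν) :=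
    ((hR.integrable_mul (memLp_coord hD j)).comp_fst ν).const_mul _
  have h2 : Integrable (fun p : 𝓧 × ℝ => (-2 * D p.1 j) * p.2) (μ.prod ν) :=
    (((memLp_coord hD j).integrable (by norm_num)).const_mul _).mul_prod
      (hν.integrable (by norm_num))
  have h3 : ∀ p : 𝓧 × ℝ, scoreFun R D p j = -2 * (R p.1 * D p.1 j) + (-2 * D p.1 j) * p.2 :=
    fun p => by simp only [scoreFun, PiLp.smul_apply, smul_eq_mul]; ring
  simp_rw [h3]
  rw [integral_add h1 h2, integral_fst_mul_snd_eq_zero hν0 (fun z => -2 * D z j), add_zero,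
    integral_fst_eq (fun z => -2 * (R z * D z j)), integral_const_mul]

lemma integral_noiseFun (hν0 : ∫ t, t ∂ν = 0) (j : Fin q) :
    ∫ p, noiseFun D p j ∂(μ.prod ν) = 0 := by
  have h3 : ∀ p : 𝓧 × ℝ, noiseFun D p j = (2 * D p.1 j) * p.2 :=
    fun p => by simp only [noiseFun, PiLp.smul_apply, smul_eq_mul]; ring
  simp_rw [h3]
  exact integral_fst_mul_snd_eq_zero hν0 (fun z => 2 * D z j)

lemma integral_noiseFun_mul (j k : Fin q) :
    ∫ p, noiseFun D p j * noiseFun D p k ∂(μ.prod ν) =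
      4 * (∫ t, t ^ 2 ∂ν) * ∫ z, D z j * D z k ∂μ := by
  have h3 : ∀ p : 𝓧 × ℝ, noiseFun D p j * noiseFun D p k = (D p.1 j * D p.1 k) * (4 * p.2 ^ 2) :=
    fun p => by simp only [noiseFun, PiLp.smul_apply, smul_eq_mul]; ring
  simp_rw [h3]
  rw [integral_prod_mul (fun z => D z j * D z k) fun t => 4 * t ^ 2, integral_const_mul]
  ring

/-- The decomposition of the second moments of the score into noise and model bias. -/
lemma integral_scoreFun_mul (hR : MemLp R 2 μ) (hD : MemLp D 2 μ) (hν : MemLp id 2 ν)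
    (hν0 : ∫ t, t ∂ν = 0) (hs : MemLp (scoreFun R D) 2 (μ.prod ν)) (j k : Fin q) :
    ∫ p, scoreFun R D p j * scoreFun R D p k ∂(μ.prod ν) =
      4 * (∫ t, t ^ 2 ∂ν) * ∫ z, D z j * D z k ∂μ + 4 * ∫ z, R z ^ 2 * (D z j * D z k) ∂μ := by
  have hRD := memLp_residual_smul hR hD hν hs
  have hRDi : ∀ l, MemLp (fun z => R z * D z l) 2 μ := fun l => memLp_coord hRD l
  have h1 : Integrable (fun p : 𝓧 × ℝ => 4 * (R p.1 ^ 2 * (D p.1 j * D p.1 k))) (μ.prod ν) := by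
    have := (((hRDi j).integrable_mul (hRDi k)).comp_fst ν).const_mul 4
    refine this.congr (ae_of_all _ fun p => ?_)
    simp only [Pi.mul_apply]
    ring
  have h2 : Integrable (fun p : 𝓧 × ℝ => (8 * (R p.1 * D p.1 j * D p.1 k)) * p.2) (μ.prod ν) :=
    (((hRDi j).integrable_mul (memLp_coord hD k)).const_mul 8).mul_prod
      (hν.integrable (by norm_num))
  have h3 : Integrable (fun p : 𝓧 × ℝ => noiseFun D p j * noiseFun D p k) (μ.prod ν) :=
    (memLp_coord (memLp_noiseFun hD hν) j).integrable_mul (memLp_coord (memLp_noiseFun hD hν) k)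
  have h4 : ∀ p : 𝓧 × ℝ, scoreFun R D p j * scoreFun R D p k =
      4 * (R p.1 ^ 2 * (D p.1 j * D p.1 k)) + (8 * (R p.1 * D p.1 j * D p.1 k)) * p.2 +
        noiseFun D p j * noiseFun D p k := fun p => by
    simp only [scoreFun, noiseFun, PiLp.smul_apply, smul_eq_mul]; ring
  simp_rw [h4]
  have h12 : Integrable (fun p : 𝓧 × ℝ => 4 * (R p.1 ^ 2 * (D p.1 j * D p.1 k)) +
      (8 * (R p.1 * D p.1 j * D p.1 k)) * p.2) (μ.prod ν) := h1.add h2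
  rw [integral_add h12 h3, integral_add h1 h2, integral_noiseFun_mul,
    integral_fst_mul_snd_eq_zero hν0 (fun z => 8 * (R z * D z j * D z k)),
    integral_fst_eq (fun z => 4 * (R z ^ 2 * (D z j * D z k))), integral_const_mul]
  ring

end Moments

section Linear

variable {S 𝓩 : Type*} [MeasurableSpace S] [MeasurableSpace 𝓩] {P : Measure S}

lemma IsLittleOpInvSqrt.congr {Y Y' : ℕ → S → ℝ≥0∞} (h : IsLittleOpInvSqrt P Y)
    (hYY' : ∀ᵐ ω ∂P, ∀ n, Y n ω = Y' n ω) : IsLittleOpInvSqrt P Y' := by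
  rw [isLittleOpInvSqrt_iff] at h ⊢
  refine h.congr' (eventually_probFilter_of_ae ?_)
  filter_upwards [hYY'] with ω hω n
  rw [hω n]

variable [IsProbabilityMeasure P] {ρ : Measure 𝓩} {Z : ℕ → S → 𝓩} {q : ℕ}

/-- An estimator whose expansion is a matrix `A` times the mean of `s` is asymptotically normal
with covariance matrix `A C Aᵀ`, where `C` is the second moment matrix of `s`. -/
lemma IsSample.hasAsymptoticCovariance_toEuclideanLin (hZ : IsSample P ρ Z)
    {s : 𝓩 → EuclideanSpace ℝ (Fin q)} (hs : MemLp s 2 ρ) (hs0 : ∀ j, ∫ p, s p j ∂ρ = 0)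
    {C : Matrix (Fin q) (Fin q) ℝ} (hC : ∀ j k, C j k = ∫ p, s p j * s p k ∂ρ)
    (A : Matrix (Fin q) (Fin q) ℝ)
    {T : ℕ → S → EuclideanSpace ℝ (Fin q)} {θ : EuclideanSpace ℝ (Fin q)}
    (hT : ∀ n, AEMeasurable (T n) P)
    (hexp : IsLittleOpInvSqrt P fun n ω => ‖T n ω - θ -
      A.toEuclideanLin ((1 / (n : ℝ)) • ∑ i ∈ Finset.range n, s (Z i ω))‖ₑ) :
    HasAsymptoticCovariance P T θ (A * C * A.transpose) := by
  have : IsProbabilityMeasure ρ := by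
    rw [← hZ.map_eq 0]; exact Measure.isProbabilityMeasure_map (hZ.measurable 0).aemeasurable
  have hcoord : ∀ p j, A.toEuclideanLin (s p) j = ∑ l, A j l * s p l := fun p j => by
    simp [Matrix.toLpLin_apply, Matrix.mulVec, dotProduct]
  have hsi : ∀ l, Integrable (fun p => s p l) ρ := fun l =>
    (memLp_coord hs l).integrable (by norm_num)
  refine hZ.hasAsymptoticCovariance (f := fun p => A.toEuclideanLin (s p))
    (A.toEuclideanLin.toContinuousLinearMap.comp_memLp' hs) (fun j => ?_) (fun j k => ?_) hT ?_
  · simp_rw [hcoord]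
    rw [integral_finsetSum _ fun l _ => (hsi l).const_mul _]
    simp [integral_const_mul, hs0]
  · simp_rw [hcoord, Finset.sum_mul_sum]
    have hint : ∀ l m, Integrable (fun p => A j l * s p l * (A k m * s p m)) ρ := fun l m =>
      ((memLp_coord hs l).const_mul _).integrable_mul ((memLp_coord hs m).const_mul _)
    rw [integral_finsetSum _ fun l _ => integrable_finsetSum _ fun m _ => hint l m]
    simp only [Matrix.mul_apply, Matrix.transpose_apply, Finset.sum_mul]
    rw [Finset.sum_comm]
    refine Finset.sum_congr rfl fun l _ => ?_
    rw [integral_finsetSum _ fun m _ => hint l m]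
    refine Finset.sum_congr rfl fun m _ => ?_
    rw [hC, ← integral_const_mul, ← integral_mul_const]
    exact integral_congr_ae (ae_of_all _ fun p => by ring)
  · simpa only [map_smul, map_sum] using hexp

end Linear

/-! ### Derivatives of the squared residual -/

section SquaredResidual

variable {q : ℕ}

lemma gradient_apply (f : EuclideanSpace ℝ (Fin q) → ℝ) (θ : EuclideanSpace ℝ (Fin q))
    (j : Fin q) : gradient f θ j = fderiv ℝ f θ (EuclideanSpace.single j 1) := by
  have := InnerProductSpace.toDual_symm_apply (𝕜 := ℝ) (x := EuclideanSpace.single j (1 : ℝ))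
    (y := fderiv ℝ f θ)
  rw [EuclideanSpace.inner_single_right] at this
  simpa [gradient] using this

lemma hasFDerivAt_sub_sq {E : Type*} [NormedAddCommGroup E] [NormedSpace ℝ E] {f : E → ℝ}
    {f' : E →L[ℝ] ℝ} {θ : E} (c : ℝ) (hf : HasFDerivAt f f' θ) :
    HasFDerivAt (fun t => (c - f t) ^ 2) ((-2 * (c - f θ)) • f') θ := by
  refine ((hf.const_sub c).pow 2).congr_fderiv ?_
  ext v
  simp

lemma gradient_sub_sq {f : EuclideanSpace ℝ (Fin q) → ℝ} {θ : EuclideanSpace ℝ (Fin q)} (c : ℝ)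
    (hf : DifferentiableAt ℝ f θ) :
    gradient (fun t => (c - f t) ^ 2) θ = (-2 * (c - f θ)) • gradient f θ := by
  simp only [gradient, (hasFDerivAt_sub_sq c hf.hasFDerivAt).fderiv, map_smul]

lemma hessianMatrix_sub_sq {f : EuclideanSpace ℝ (Fin q) → ℝ} {θ₀ : EuclideanSpace ℝ (Fin q)}
    {r ℓ : ℝ} (hf : IsC2LipAt f θ₀ r ℓ) (hr : 0 < r) (c : ℝ) (j k : Fin q) :
    hessianMatrix (fun t => (c - f t) ^ 2) θ₀ j k =
      2 * (fderiv ℝ f θ₀ (EuclideanSpace.single k 1) * fderiv ℝ f θ₀ (EuclideanSpace.single j 1) -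
        (c - f θ₀) * fderiv ℝ (fderiv ℝ f) θ₀ (EuclideanSpace.single k 1)
          (EuclideanSpace.single j 1)) := by
  have hmem := Metric.mem_ball_self (x := θ₀) hr
  have h1 : partialDeriv k (fun t => (c - f t) ^ 2) =ᶠ[𝓝 θ₀]
      fun t => -2 * (c - f t) * fderiv ℝ f t (EuclideanSpace.single k 1) := by
    filter_upwards [Metric.ball_mem_nhds θ₀ hr] with t ht
    simp [partialDeriv, (hasFDerivAt_sub_sq c (hf.hasFDerivAt ht)).fderiv]
  have h2 : HasFDerivAt (fun t => fderiv ℝ f t (EuclideanSpace.single k 1))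
      ((fderiv ℝ (fderiv ℝ f) θ₀).flip (EuclideanSpace.single k 1)) θ₀ := by
    refine ((hf.hasFDerivAt_fderiv hmem).clm_apply (hasFDerivAt_const _ _)).congr_fderiv ?_
    ext v
    simp
  have h3 := (((hf.hasFDerivAt hmem).const_sub c).const_mul (-2)).fun_mul h2
  rw [hessianMatrix, Matrix.of_apply, partialDeriv, h1.fderiv_eq, h3.fderiv]
  simp only [add_apply, smul_apply, smul_eq_mul, ContinuousLinearMap.flip_apply, neg_apply]
  rw [hf.symm hr (EuclideanSpace.single j 1)]
  ring

end SquaredResidual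

/-! ### The uniform distribution on `Ω` -/

section Uniform

variable {𝓧 : Type*} [MeasurableSpace 𝓧] {m : Measure 𝓧} {Ω : Set 𝓧}

lemma ae_cond_iff (htop : m Ω ≠ ∞) {Q : 𝓧 → Prop} :
    (∀ᵐ z ∂(ProbabilityTheory.cond m Ω), Q z) ↔ ∀ᵐ z ∂(m.restrict Ω), Q z :=
  Measure.ae_ennreal_smul_measure_iff (ENNReal.inv_ne_zero.2 htop)

lemma memLp_cond (h0 : m Ω ≠ 0) {f : 𝓧 → ℝ} (hf : MemLp f 2 (m.restrict Ω)) :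
    MemLp f 2 (ProbabilityTheory.cond m Ω) :=
  hf.smul_measure (ENNReal.inv_ne_top.2 h0)

/-- For square integrable functions the `L²` seminorms order the mean squares. -/
lemma integral_sq_cond_lt (h0 : m Ω ≠ 0) (htop : m Ω ≠ ∞) {f g : 𝓧 → ℝ}
    (hf : MemLp f 2 (m.restrict Ω)) (hg : MemLp g 2 (m.restrict Ω))
    (hfg : eLpNorm f 2 (m.restrict Ω) < eLpNorm g 2 (m.restrict Ω)) :
    ∫ z, f z ^ 2 ∂(ProbabilityTheory.cond m Ω) < ∫ z, g z ^ 2 ∂(ProbabilityTheory.cond m Ω) := by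
  rw [hf.eLpNorm_eq_integral_rpow_norm (by norm_num) (by norm_num),
    hg.eLpNorm_eq_integral_rpow_norm (by norm_num) (by norm_num)] at hfg
  have h1 := lt_of_not_ge fun h => not_lt.2 (ENNReal.ofReal_le_ofReal h) hfg
  rw [Real.rpow_lt_rpow_iff (by positivity) (by positivity) (by norm_num)] at h1
  simp only [ENNReal.toReal_ofNat, Real.rpow_ofNat, Real.norm_eq_abs, sq_abs] at h1
  rw [ProbabilityTheory.cond, integral_smul_measure, integral_smul_measure, smul_eq_mul,
    smul_eq_mul]
  exact mul_lt_mul_of_pos_left h1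
    (ENNReal.toReal_pos (ENNReal.inv_ne_zero.2 htop) (ENNReal.inv_ne_top.2 h0))

end Uniform

/-! ### The least squares equations of the emulator -/

section Emulator

variable {S : Type*} [MeasurableSpace S] {P : Measure S}

/-- A uniform error of order `o_p(n^{-1/2})` is finite with probability tending to one, and its
real value is of the same order. -/
lemma IsLittleOpInvSqrt.toReal {Z : ℕ → S → ℝ≥0∞} (h : IsLittleOpInvSqrt P Z) :
    Tendsto (fun p : ℕ × S => √(p.1 : ℝ) * (Z p.1 p.2).toReal) (probFilter P) (𝓝 0) ∧
    Tendsto (fun p : ℕ × S => (Z p.1 p.2).toReal) (probFilter P) (𝓝 0) ∧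
    ∀ᶠ p in probFilter P, Z p.1 p.2 ≠ ∞ := by
  rw [isLittleOpInvSqrt_iff] at h
  have h1 : Tendsto (fun p : ℕ × S => √(p.1 : ℝ) * (Z p.1 p.2).toReal) (probFilter P) (𝓝 0) := by
    have := (ENNReal.tendsto_toReal ENNReal.zero_ne_top).comp h
    simpa [Function.comp_def, ENNReal.toReal_mul, ENNReal.toReal_ofReal, Real.sqrt_nonneg]
      using this
  have hn : ∀ᶠ p : ℕ × S in probFilter P, 1 ≤ p.1 :=
    tendsto_fst_probFilter.eventually (eventually_ge_atTop 1)
  refine ⟨h1, squeeze_zero' (Eventually.of_forall fun _ => ENNReal.toReal_nonneg) ?_ h1, ?_⟩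
  · filter_upwards [hn] with p hp
    have : 1 ≤ √(p.1 : ℝ) := Real.one_le_sqrt.2 (by exact_mod_cast hp)
    nlinarith [ENNReal.toReal_nonneg (a := Z p.1 p.2)]
  · filter_upwards [hn, h.eventually_lt_const ENNReal.zero_lt_top] with p hp hlt htop
    rw [htop, ENNReal.mul_top] at hlt
    · exact lt_irrefl _ hlt
    · have : (0 : ℝ) < p.1 := by exact_mod_cast hp
      simpa using Real.sqrt_pos.2 this

/-- The first-order condition of least squares at an interior point. -/
lemma IsLeastSquares.empMean_eq_zero {d q n : ℕ} {Θ : Set (EuclideanSpace ℝ (Fin q))}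
    {x : ℕ → EuclideanSpace ℝ (Fin d)} {y : ℕ → ℝ}
    {g : EuclideanSpace ℝ (Fin d) → EuclideanSpace ℝ (Fin q) → ℝ}
    {θhat : EuclideanSpace ℝ (Fin q)} (h : IsLeastSquares Θ n x y g θhat)
    (hint : θhat ∈ interior Θ) (hd : ∀ i, DifferentiableAt ℝ (g (x i)) θhat)
    (v : EuclideanSpace ℝ (Fin q)) :
    empMean n (fun i => (y i - g (x i) θhat) * fderiv ℝ (g (x i)) θhat v) = 0 := by
  have hmin : IsLocalMin (fun θ => ∑ i ∈ Finset.range n, (y i - g (x i) θ) ^ 2) θhat := by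
    filter_upwards [mem_interior_iff_mem_nhds.1 hint] with θ hθ using h.2 θ hθ
  have hder : HasFDerivAt (fun θ => ∑ i ∈ Finset.range n, (y i - g (x i) θ) ^ 2)
      (∑ i ∈ Finset.range n, (-2 * (y i - g (x i) θhat)) • fderiv ℝ (g (x i)) θhat) θhat :=
    HasFDerivAt.fun_sum fun i _ => hasFDerivAt_sub_sq (y i) (hd i).hasFDerivAt
  have := congrArg (fun T : EuclideanSpace ℝ (Fin q) →L[ℝ] ℝ => T v)
    (hmin.hasFDerivAt_eq_zero hder)
  simp only [sum_apply, smul_apply, smul_eq_mul, zero_apply, mul_assoc, ← Finset.mul_sum] at this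
  rw [empMean]
  simp only [mul_eq_zero] at this ⊢
  right
  exact this.resolve_left (by norm_num)

end Emulator

/-! ### Comparison of the covariance matrices -/

section Comparison

variable {q : ℕ} {V B S₁ S₂ : Matrix (Fin q) (Fin q) ℝ}

/-- The asymptotic covariance matrices differ by `4 V⁻¹ B V⁻¹`. -/
lemma comparison (hV : IsUnit V) (hVsymm : V.transpose = V) (hB : B.PosSemidef)
    (hS : S₂ = S₁ + (4 : ℝ) • B) :
    (V⁻¹ * S₂ * V⁻¹ - V⁻¹ * S₁ * V⁻¹).PosSemidef ∧
    (V⁻¹ * S₂ * V⁻¹ = V⁻¹ * S₁ * V⁻¹ ↔ B = 0) := by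
  have hdet : IsUnit V.det := (Matrix.isUnit_iff_isUnit_det _).1 hV
  have hdiff : V⁻¹ * S₂ * V⁻¹ - V⁻¹ * S₁ * V⁻¹ = (4 : ℝ) • (V⁻¹ * B * V⁻¹) := by
    rw [hS, mul_add, add_mul, add_sub_cancel_left, Matrix.mul_smul, Matrix.smul_mul]
  have hT : V⁻¹.conjTranspose = V⁻¹ := by
    rw [Matrix.conjTranspose_eq_transpose_of_trivial, Matrix.transpose_nonsing_inv, hVsymm]
  constructor
  · rw [hdiff]
    have := hB.mul_mul_conjTranspose_same V⁻¹
    rw [hT] at this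
    exact this.smul (by norm_num)
  · rw [← sub_eq_zero, hdiff]
    constructor
    · intro h
      have h1 : V⁻¹ * B * V⁻¹ = 0 := (smul_eq_zero.1 h).resolve_left (by norm_num)
      have h2 : V * (V⁻¹ * B * V⁻¹) * V = B := by
        rw [mul_assoc V⁻¹, Matrix.mul_nonsing_inv_cancel_left _ _ hdet,
          Matrix.nonsing_inv_mul_cancel_right _ _ hdet]
      rw [← h2, h1, mul_zero, zero_mul]
    · rintro rfl
      simp

end Comparison

lemma identDistrib_of_subsingleton {S₁ S₂ F : Type*} [MeasurableSpace S₁] [MeasurableSpace S₂]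
    [MeasurableSpace F] [Subsingleton F] {P₁ : Measure S₁} {P₂ : Measure S₂}
    [IsProbabilityMeasure P₁] [IsProbabilityMeasure P₂] (X : S₁ → F) (Y : S₂ → F) :
    IdentDistrib X Y P₁ P₂ := by
  have hX : Measurable X := measurable_of_subsingleton_codomain _
  have hY : Measurable Y := measurable_of_subsingleton_codomain _
  refine ⟨hX.aemeasurable, hY.aemeasurable, ?_⟩
  ext s hs
  rw [Measure.map_apply hX hs, Measure.map_apply hY hs]
  rcases Subsingleton.set_cases (p := fun s => s = ∅ ∨ s = Set.univ) (Or.inl rfl) (Or.inr rfl) s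
    with rfl | rfl <;> simp

/-- With no parameters every sequence of estimators is trivially asymptotically normal. -/
lemma hasAsymptoticCovariance_of_isEmpty {S : Type*} [MeasurableSpace S] {P : Measure S}
    [IsProbabilityMeasure P] {T : ℕ → S → EuclideanSpace ℝ (Fin 0)}
    (θ : EuclideanSpace ℝ (Fin 0)) (C : Matrix (Fin 0) (Fin 0) ℝ) :
    HasAsymptoticCovariance P T θ C := by
  have hC : C = 0 := Subsingleton.elim _ _
  refine ⟨hC ▸ Matrix.PosSemidef.zero, ?_⟩
  exact tendstoInDistribution_of_identDistrib 0 (fun _ => identDistrib_of_subsingleton _ _)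
    (identDistrib_of_subsingleton _ _)

end OLSCalibration

end

open OLSCalibration in
theorem theorem3 {S : Type*} [MeasurableSpace S] (P : Measure S) [IsProbabilityMeasure P]
    {d q : ℕ}
    (Ω : Set (EuclideanSpace ℝ (Fin d))) (hΩ_compact : IsCompact Ω) (hΩ_convex : Convex ℝ Ω)
    (Θ : Set (EuclideanSpace ℝ (Fin q))) (hΘ_compact : IsCompact Θ)
    -- the true process
    (ζ : EuclideanSpace ℝ (Fin d) → ℝ) (hζ : AEStronglyMeasurable ζ (volume.restrict Ω))
    -- the computer code
    (ys : EuclideanSpace ℝ (Fin d) → EuclideanSpace ℝ (Fin q) → ℝ)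
    (hys_meas : ∀ θ ∈ Θ, AEStronglyMeasurable (fun z => ys z θ) (volume.restrict Ω))
    (hys_cont : ∀ z ∈ Ω, ContinuousOn (ys z) Θ)
    (hys_diff : ∀ z ∈ Ω, ∀ θ ∈ interior Θ, DifferentiableAt ℝ (ys z) θ)
    -- A1
    (x : ℕ → S → EuclideanSpace ℝ (Fin d)) (e : ℕ → S → ℝ)
    (hx_meas : ∀ i, Measurable (x i)) (he_meas : ∀ i, Measurable (e i))
    (hxe_indep : IndepFun (fun ω i => x i ω) (fun ω i => e i ω) P)
    (hx_indep : iIndepFun x P) (hx_unif : ∀ i, pdf.IsUniform (x i) Ω P volume)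
    (he_indep : iIndepFun e P) (he_ident : ∀ i, IdentDistrib (e i) (e 0) P P)
    (he_mean : ∫ ω, e 0 ω ∂P = 0) (he_var : MemLp (e 0) 2 P)
    -- A2
    (θstar : EuclideanSpace ℝ (Fin q))
    (hθ_min : OLSCalibration.IsUniqueL2Projection Ω Θ ζ ys θstar)
    (hθ_int : θstar ∈ interior Θ)
    -- A3
    (hA3 : (⨆ θ ∈ Θ, eLpNorm (fun z => ys z θ) 2 (volume.restrict Ω)) < ∞)
    -- A4
    (hA4 : IsUnit (OLSCalibration.matV Ω ζ ys θstar))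
    -- `ys(z, ·)` is of class `C^{2,1}` near `θstar`
    (U : Set (EuclideanSpace ℝ (Fin q))) (hU_open : IsOpen U) (hU_mem : θstar ∈ U)
    (hU_sub : U ⊆ Θ)
    (hC2 : ∀ z ∈ Ω, ContDiffOn ℝ 2 (ys z) U)
    (L : EuclideanSpace ℝ (Fin d) → ℝ) (hL : MemLp L 2 (volume.restrict Ω))
    (hLip : ∀ z ∈ Ω, ∀ θ ∈ U, ∀ θ' ∈ U,
      ‖fderiv ℝ (fderiv ℝ (ys z)) θ - fderiv ℝ (fderiv ℝ (ys z)) θ'‖ ≤ L z * ‖θ - θ'‖)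
    -- the score at `θstar` is square integrable, so that the matrix `S₂` below is finite
    (hS₂ : MemLp (OLSCalibration.score ζ ys x e θstar 0) 2 P)
    -- the emulators, which may depend on the data and on further randomness, with C1 and C2
    (yhat : ℕ → S → EuclideanSpace ℝ (Fin d) → EuclideanSpace ℝ (Fin q) → ℝ)
    (hyhat_diff : ∀ᵐ ω ∂P, ∀ n, ∀ z ∈ Ω, ∀ θ ∈ interior Θ, DifferentiableAt ℝ (yhat n ω z) θ)
    (hC_1 : OLSCalibration.IsLittleOpInvSqrt P fun n ω =>
      ⨆ z ∈ Ω, ⨆ θ ∈ Θ, ‖yhat n ω z θ - ys z θ‖ₑ)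
    (hC_2 : ∀ j : Fin q, OLSCalibration.IsLittleOpInvSqrt P fun n ω =>
      ⨆ z ∈ Ω, ⨆ θ ∈ interior Θ,
        ‖OLSCalibration.partialDeriv j (yhat n ω z) θ -
          OLSCalibration.partialDeriv j (ys z) θ‖ₑ)
    -- the OLS calibration estimator
    (θhat : ℕ → S → EuclideanSpace ℝ (Fin q)) (hθhat_meas : ∀ n, AEMeasurable (θhat n) P)
    (hθhat : ∀ᵐ ω ∂P, ∀ n, OLSCalibration.IsLeastSquares Θ n (fun i => x i ω)
      (fun i => OLSCalibration.response ζ x e i ω) (yhat n ω) (θhat n ω)) :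
    let V := OLSCalibration.matV Ω ζ ys θstar
    let B := OLSCalibration.matB Ω ζ ys θstar
    let S₁ := OLSCalibration.matSigma1 P Ω ys e θstar
    let S₂ := OLSCalibration.matSigma2 P ζ ys x e θstar
    -- consistency
    TendstoInMeasure P θhat atTop (fun _ => θstar) ∧
    -- asymptotic expansion
    OLSCalibration.IsLittleOpInvSqrt P (fun n ω =>
      ‖(θhat n ω - θstar) - (-(V⁻¹.toEuclideanLin
        ((1 / (n : ℝ)) • ∑ i ∈ Finset.range n, OLSCalibration.score ζ ys x e θstar i ω)))‖ₑ) ∧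
    -- asymptotic covariance matrix of OLS calibration
    OLSCalibration.HasAsymptoticCovariance P θhat θstar (V⁻¹ * S₂ * V⁻¹) ∧
    -- asymptotic covariance matrix of every estimator with the expansion of `L²` calibration
    (∀ T : ℕ → S → EuclideanSpace ℝ (Fin q), (∀ n, AEMeasurable (T n) P) →
      OLSCalibration.IsLittleOpInvSqrt P (fun n ω =>
        ‖(T n ω - θstar) - (2 : ℝ) • V⁻¹.toEuclideanLin
          ((1 / (n : ℝ)) • ∑ i ∈ Finset.range n, e i ω • gradient (ys (x i ω)) θstar)‖ₑ) →
      OLSCalibration.HasAsymptoticCovariance P T θstar (V⁻¹ * S₁ * V⁻¹)) ∧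
    -- comparison of the two
    S₂ = S₁ + (4 : ℝ) • B ∧
    (V⁻¹ * S₂ * V⁻¹ - V⁻¹ * S₁ * V⁻¹).PosSemidef ∧
    (V⁻¹ * S₂ * V⁻¹ = V⁻¹ * S₁ * V⁻¹ ↔ B = 0) ∧
    (ζ =ᵐ[volume.restrict Ω] (fun z => ys z θstar) → V⁻¹ * S₂ * V⁻¹ = V⁻¹ * S₁ * V⁻¹) ∧
    ((∀ᵐ z ∂(volume.restrict Ω), gradient (ys z) θstar ≠ 0) →
      V⁻¹ * S₂ * V⁻¹ = V⁻¹ * S₁ * V⁻¹ →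
      ζ =ᵐ[volume.restrict Ω] (fun z => ys z θstar)) := by
  intro V B S₁ S₂
  -- the law of the inputs is the uniform distribution on a set of positive finite volume
  have hvol_top : volume Ω ≠ ∞ := hΩ_compact.measure_lt_top.ne
  have hx_map : ∀ i, P.map (x i) = ProbabilityTheory.cond volume Ω := hx_unif
  set μ : Measure (EuclideanSpace ℝ (Fin d)) := ProbabilityTheory.cond volume Ω with hμ
  have hμ_prob : IsProbabilityMeasure μ := by
    rw [← hx_map 0]; exact Measure.isProbabilityMeasure_map (hx_meas 0).aemeasurable
  have hvol_pos : volume Ω ≠ 0 := fun h0 => by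
    have h1 : μ Set.univ = 1 := measure_univ
    rw [hμ, ProbabilityTheory.cond, Measure.restrict_eq_zero.2 h0] at h1
    simp at h1
  rcases Nat.eq_zero_or_pos q with rfl | hq
  · have hzero : ∀ v : EuclideanSpace ℝ (Fin 0), ‖v‖ₑ = 0 := fun v => by
      rw [Subsingleton.elim v 0, enorm_zero]
    refine ⟨?_, ?_, hasAsymptoticCovariance_of_isEmpty _ _,
      fun T _ _ => hasAsymptoticCovariance_of_isEmpty _ _, Subsingleton.elim _ _, ?_,
      iff_of_true (Subsingleton.elim _ _) (Subsingleton.elim _ _),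
      fun _ => Subsingleton.elim _ _, fun h _ => ?_⟩
    · rw [tendstoInMeasure_const_iff]
      exact tendsto_const_nhds.congr fun p => Subsingleton.elim θstar _
    · rw [isLittleOpInvSqrt_iff]
      simp only [hzero, mul_zero]
      exact tendsto_const_nhds
    · rw [Subsingleton.elim (V⁻¹ * S₂ * V⁻¹ - V⁻¹ * S₁ * V⁻¹) 0]
      exact Matrix.PosSemidef.zero
    · filter_upwards [h] with z hz
      exact absurd (Subsingleton.elim _ _) hz
  have hx : IsSample P μ x := ⟨hx_meas, hx_map, hx_indep⟩
  set ν : Measure ℝ := P.map (e 0) with hν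
  have he : IsSample P ν e := ⟨he_meas, fun i => (he_ident i).map_eq, he_indep⟩
  have hν_prob : IsProbabilityMeasure ν :=
    Measure.isProbabilityMeasure_map (he_meas 0).aemeasurable
  have hν0 : ∫ t, t ∂ν = 0 := by
    rw [← he_mean]
    exact (he.integral_comp (f := id) aestronglyMeasurable_id 0).symm
  have hνL : MemLp id 2 ν :=
    (memLp_map_measure_iff aestronglyMeasurable_id (he_meas 0).aemeasurable).2 he_var
  have hνsq : ∫ ω, e 0 ω ^ 2 ∂P = ∫ t, t ^ 2 ∂ν :=
    he.integral_comp (f := fun t => t ^ 2) (by fun_prop) 0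
  have hZ : IsSample P (μ.prod ν) (fun i ω => (x i ω, e i ω)) := isSample_prodMk hx he hxe_indep
  have hΩμ : ∀ᵐ z ∂μ, z ∈ Ω :=
    (ae_cond_iff hvol_top).2 (ae_restrict_mem hΩ_compact.measurableSet)
  have hΩρ : ∀ᵐ p ∂(μ.prod ν), p.1 ∈ Ω := measurePreserving_fst.quasiMeasurePreserving.ae hΩμ
  have hxΩ : ∀ᵐ ω ∂P, ∀ i, x i ω ∈ Ω := hx.ae hΩμ
  -- the local smoothness of the code
  obtain ⟨r, hr, hrU⟩ := Metric.isOpen_iff.1 hU_open θstar hU_mem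
  have hball : Metric.ball θstar r ⊆ Θ := hrU.trans hU_sub
  have hθΘ : θstar ∈ Θ := hθ_min.1
  have hC : ∀ z ∈ Ω, IsC2LipAt (ys z) θstar r |L z| := fun z hz =>
    ⟨(hC2 z hz).mono hrU, fun θ hθ => (hLip z hz θ (hrU hθ) θstar hU_mem).trans (by
      gcongr; exact le_abs_self _)⟩
  have hCμ : ∀ᵐ z ∂μ, IsC2LipAt (ys z) θstar r |L z| := hΩμ.mono hC
  have hLμ : MemLp (fun z => |L z|) 2 μ := (memLp_cond hvol_pos hL).abs
  have hysΩ : ∀ θ ∈ Θ, MemLp (fun z => ys z θ) 2 (volume.restrict Ω) := fun θ hθ =>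
    ⟨hys_meas θ hθ, (le_iSup₂ (f := fun θ (_ : θ ∈ Θ) =>
      eLpNorm (fun z => ys z θ) 2 (volume.restrict Ω)) θ hθ).trans_lt hA3⟩
  have hysμ : ∀ θ ∈ Metric.ball θstar r, MemLp (fun z => ys z θ) 2 μ := fun θ hθ =>
    memLp_cond hvol_pos (hysΩ θ (hball hθ))
  -- the residual is square integrable, because the distance at `θstar` is below another one
  have hRΩ : MemLp (fun z => ζ z - ys z θstar) 2 (volume.restrict Ω) := by
    refine ⟨hζ.sub (hys_meas θstar hθΘ), ?_⟩
    set v : EuclideanSpace ℝ (Fin q) := EuclideanSpace.single ⟨0, hq⟩ (r / 2) with hv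
    have hvn : ‖v‖ = r / 2 := by simp [hv, abs_of_pos hr]
    refine (hθ_min.2 (θstar + v) (hball ?_) ?_).trans_le le_top
    · rw [Metric.mem_ball, dist_eq_norm, add_sub_cancel_left, hvn]
      linarith
    · intro h
      have : v = 0 := by simpa using h
      rw [this, norm_zero] at hvn
      linarith
  have hresΩ : ∀ θ ∈ Θ, MemLp (fun z => ζ z - ys z θ) 2 (volume.restrict Ω) := fun θ hθ => by
    refine ((hRΩ.add (hysΩ θstar hθΘ)).sub (hysΩ θ hθ)).ae_eq (ae_of_all _ fun z => ?_)
    simp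
  set R : EuclideanSpace ℝ (Fin d) → ℝ := fun z => ζ z - ys z θstar with hR
  have hRμ : MemLp R 2 μ := memLp_cond hvol_pos hRΩ
  have hminμ : ∀ θ ∈ Θ, θ ≠ θstar → ∫ z, R z ^ 2 ∂μ < ∫ z, (ζ z - ys z θ) ^ 2 ∂μ :=
    fun θ hθ hne => integral_sq_cond_lt hvol_pos hvol_top hRΩ (hresΩ θ hθ) (hθ_min.2 θ hθ hne)
  -- the derivatives at `θstar`
  have hDv : ∀ v, MemLp (fun z => fderiv ℝ (ys z) θstar v) 2 μ :=
    memLp_fderiv hr hysμ (fun _ => abs_nonneg _) hLμ hCμ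
  have hHv : ∀ v w, MemLp (fun z => fderiv ℝ (fderiv ℝ (ys z)) θstar v w) 2 μ :=
    memLp_fderiv_fderiv hr hysμ (fun _ => abs_nonneg _) hLμ hCμ
  set D : EuclideanSpace ℝ (Fin d) → EuclideanSpace ℝ (Fin q) :=
    fun z => gradient (ys z) θstar with hD
  have hDj : ∀ z j, D z j = fderiv ℝ (ys z) θstar (EuclideanSpace.single j 1) :=
    fun z j => gradient_apply _ _ _
  have hDμ : MemLp D 2 μ := MemLp.of_eval_piLp fun j => by
    simpa only [hDj] using hDv (EuclideanSpace.single j 1)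
  have hfoc : ∀ j, ∫ z, R z * D z j ∂μ = 0 := fun j => by
    simp only [hDj]
    refine integral_mul_fderiv_eq_zero hr hysμ (fun _ => abs_nonneg _) hLμ hCμ hRμ
      (fun θ hθ => ?_) _
    rcases eq_or_ne θ θstar with rfl | hne
    · exact le_rfl
    · exact (hminμ θ (hball hθ) hne).le
  -- the score is a function of the pair of input and error
  have hscore : ∀ᵐ ω ∂P, ∀ i, score ζ ys x e θstar i ω = scoreFun R D (x i ω, e i ω) := by
    filter_upwards [hxΩ] with ω hω i
    rw [score, gradient_sub_sq _ (hys_diff _ (hω i) _ hθ_int)]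
    simp only [scoreFun, response, hR, hD]
    congr 2
    ring
  have hsm : AEStronglyMeasurable (scoreFun R D) (μ.prod ν) :=
    aestronglyMeasurable_scoreFun hRμ hDμ
  have hs : MemLp (scoreFun R D) 2 (μ.prod ν) := by
    rw [← hZ.map_eq 0] at hsm ⊢
    refine (memLp_map_measure_iff hsm (hZ.measurable 0).aemeasurable).2 (hS₂.ae_eq ?_)
    filter_upwards [hscore] with ω hω using hω 0
  have hs0 : ∀ j, ∫ p, scoreFun R D p j ∂(μ.prod ν) = 0 := fun j => by
    rw [integral_scoreFun hRμ hDμ hνL hν0, hfoc, mul_zero]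
  have hS₂eq : ∀ j k, S₂ j k = ∫ p, scoreFun R D p j * scoreFun R D p k ∂(μ.prod ν) := by
    intro j k
    rw [← hZ.integral_comp (f := fun p => scoreFun R D p j * scoreFun R D p k)
      ((memLp_coord hs j).aestronglyMeasurable.mul (memLp_coord hs k).aestronglyMeasurable) 0]
    refine integral_congr_ae ?_
    filter_upwards [hscore] with ω hω
    rw [hω 0]
  have hS₁eq : ∀ j k, S₁ j k = ∫ p, noiseFun D p j * noiseFun D p k ∂(μ.prod ν) := by
    intro j k
    rw [integral_noiseFun_mul, ← hνsq]
    rfl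
  have hSB : S₂ = S₁ + (4 : ℝ) • B := by
    ext j k
    rw [Matrix.add_apply, hS₂eq, hS₁eq, integral_scoreFun_mul hRμ hDμ hνL hν0 hs,
      integral_noiseFun_mul]
    rfl
  have hBeq : ∀ j k, B j k = ∫ z, (R z • D z) j * (R z • D z) k ∂μ := fun j k => by
    refine integral_congr_ae (ae_of_all _ fun z => ?_)
    simp only [PiLp.smul_apply, smul_eq_mul]
    ring
  have hRD := memLp_residual_smul hRμ hDμ hνL hs
  have hBpos : B.PosSemidef := posSemidef_of_eq_integral hRD hBeq
  -- the Hessian matrix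
  have hVμ : ∀ j k, V j k = ∫ z, 2 * (fderiv ℝ (ys z) θstar (EuclideanSpace.single k 1) *
      fderiv ℝ (ys z) θstar (EuclideanSpace.single j 1) - R z *
      fderiv ℝ (fderiv ℝ (ys z)) θstar (EuclideanSpace.single k 1)
        (EuclideanSpace.single j 1)) ∂μ := fun j k => by
    refine integral_congr_ae ?_
    filter_upwards [hCμ] with z hz
    exact hessianMatrix_sub_sq hz hr (ζ z) j k
  have hVsymm : V.transpose = V := by
    ext j k
    rw [Matrix.transpose_apply, hVμ, hVμ]
    refine integral_congr_ae ?_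
    filter_upwards [hCμ] with z hz
    simp only [hR]
    rw [hz.symm hr (EuclideanSpace.single j 1), mul_comm (fderiv ℝ (ys z) θstar _)]
  have hVinv : V⁻¹.transpose = V⁻¹ := by rw [Matrix.transpose_nonsing_inv, hVsymm]
  obtain ⟨hdiff, hiff⟩ := comparison hA4 hVsymm hBpos hSB
  -- the emulator errors
  obtain ⟨hδn, hδ, hδfin⟩ := hC_1.toReal
  have hδ'n := tendsto_finsetSum (Finset.univ : Finset (Fin q)) fun j _ => (hC_2 j).toReal.1
  have hδ' := tendsto_finsetSum (Finset.univ : Finset (Fin q)) fun j _ => (hC_2 j).toReal.2.1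
  have hδ'fin := eventually_all.2 fun j => (hC_2 j).toReal.2.2
  simp only [Finset.sum_const_zero, ← Finset.mul_sum] at hδ'n hδ'
  have hxΩp : ∀ᶠ p in probFilter P, ∀ i, x i p.2 ∈ Ω :=
    eventually_probFilter_of_ae (by filter_upwards [hxΩ] with ω hω _ using hω)
  have hdiffp : ∀ᶠ p in probFilter P, ∀ z ∈ Ω, ∀ θ ∈ interior Θ,
      DifferentiableAt ℝ (yhat p.1 p.2 z) θ := eventually_probFilter_of_ae hyhat_diff
  have hLS : ∀ᶠ p in probFilter P, IsLeastSquares Θ p.1 (fun i => x i p.2)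
      (fun i => response ζ x e i p.2) (yhat p.1 p.2) (θhat p.1 p.2) :=
    eventually_probFilter_of_ae hθhat
  have hval : ∀ᶠ p in probFilter P, ∀ i, ∀ θ ∈ Θ,
      |yhat p.1 p.2 (x i p.2) θ - ys (x i p.2) θ| ≤
        (⨆ z ∈ Ω, ⨆ θ ∈ Θ, ‖yhat p.1 p.2 z θ - ys z θ‖ₑ).toReal := by
    filter_upwards [hxΩp, hδfin] with p h1 h2 i θ hθ
    rw [← Real.norm_eq_abs, ← toReal_enorm]
    refine ENNReal.toReal_mono h2 (le_iSup₂_of_le (x i p.2) (h1 i) ?_)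
    exact le_iSup₂ (f := fun θ (_ : θ ∈ Θ) =>
      ‖yhat p.1 p.2 (x i p.2) θ - ys (x i p.2) θ‖ₑ) θ hθ
  have hder : ∀ᶠ p in probFilter P, ∀ i, ∀ θ ∈ interior Θ,
      ‖fderiv ℝ (yhat p.1 p.2 (x i p.2)) θ - fderiv ℝ (ys (x i p.2)) θ‖ ≤
        ∑ j, (⨆ z ∈ Ω, ⨆ θ ∈ interior Θ,
          ‖partialDeriv j (yhat p.1 p.2 z) θ - partialDeriv j (ys z) θ‖ₑ).toReal := by
    filter_upwards [hxΩp, hδ'fin] with p h1 h2 i θ hθ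
    refine (norm_clm_le_sum _).trans (Finset.sum_le_sum fun j _ => ?_)
    rw [← toReal_enorm]
    refine ENNReal.toReal_mono (h2 j) (le_iSup₂_of_le (x i p.2) (h1 i) ?_)
    exact le_iSup₂ (f := fun θ (_ : θ ∈ interior Θ) =>
      ‖partialDeriv j (yhat p.1 p.2 (x i p.2)) θ - partialDeriv j (ys (x i p.2)) θ‖ₑ) θ hθ
  -- consistency
  have hres : ∀ θ ∈ Θ, MemLp (fun p : EuclideanSpace ℝ (Fin d) × ℝ => ζ p.1 + p.2 - ys p.1 θ) 2
      (μ.prod ν) := fun θ hθ => by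
    refine (((memLp_cond hvol_pos (hresΩ θ hθ)).comp_fst ν).add (hνL.comp_snd μ)).ae_eq
      (ae_of_all _ fun p => ?_)
    simp only [Pi.add_apply, id]
    ring
  have hmean : ∀ θ ∈ Θ, ∫ p : EuclideanSpace ℝ (Fin d) × ℝ,
      (ζ p.1 + p.2 - ys p.1 θ) ^ 2 ∂(μ.prod ν) =
        ∫ z, (ζ z - ys z θ) ^ 2 ∂μ + ∫ t, t ^ 2 ∂ν := fun θ hθ => by
    rw [← integral_add_snd_sq (memLp_cond hvol_pos (hresΩ θ hθ)) hνL hν0]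
    exact integral_congr_ae (ae_of_all _ fun p => by ring)
  have hcons : Tendsto (fun p : ℕ × S => θhat p.1 p.2) (probFilter P) (𝓝 θstar) := by
    refine tendsto_leastSquares hZ hΘ_compact hθΘ
      (y := fun p => ζ p.1 + p.2) (F := fun p => ys p.1)
      (fhat := fun n ω i θ => yhat n ω (x i ω) θ)
      (fun θ hθ => (hres θ hθ).integrable_sq) (hΩρ.mono fun p hp => hys_cont _ hp)
      (fun θ hθ hne => ?_) hδ hval (hLS.mono fun p hp => hp.1) (hLS.mono fun p hp => ?_)
    · rw [hmean θ hθ, hmean θstar hθΘ]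
      exact add_lt_add_left (hminμ θ hθ hne) _
    · exact mul_le_mul_of_nonneg_left (hp.2 θstar hθΘ) (by positivity)
  have hnear : ∀ᶠ p in probFilter P, θhat p.1 p.2 ∈ interior Θ :=
    hcons.eventually (isOpen_interior.mem_nhds hθ_int)
  -- the expansion, with an envelope `M` of the derivatives at `θstar`
  set M : EuclideanSpace ℝ (Fin d) → ℝ := fun z =>
    ∑ j, |fderiv ℝ (ys z) θstar (EuclideanSpace.single j 1)| +
      ∑ j, ∑ k, |fderiv ℝ (fderiv ℝ (ys z)) θstar (EuclideanSpace.single j 1)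
        (EuclideanSpace.single k 1)| + |L z| with hM
  have hMμ : MemLp M 2 μ :=
    ((memLp_finsetSum _ fun j _ => (hDv _).abs).add
      (memLp_finsetSum _ fun j _ => memLp_finsetSum _ fun k _ => (hHv _ _).abs)).add hLμ
  have hM1 : ∀ z, 0 ≤ ∑ j, |fderiv ℝ (ys z) θstar (EuclideanSpace.single j 1)| :=
    fun z => by positivity
  have hM2 : ∀ z, 0 ≤ ∑ j, ∑ k, |fderiv ℝ (fderiv ℝ (ys z)) θstar (EuclideanSpace.single j 1)
      (EuclideanSpace.single k 1)| := fun z => by positivity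
  have hDM : ∀ z, ‖fderiv ℝ (ys z) θstar‖ ≤ M z := fun z => by
    have := norm_clm_le_sum (fderiv ℝ (ys z) θstar)
    simp only [Real.norm_eq_abs] at this
    linarith [hM2 z, abs_nonneg (L z)]
  have hHM : ∀ z, ‖fderiv ℝ (fderiv ℝ (ys z)) θstar‖ ≤ M z := fun z => by
    have h1 := norm_clm_le_sum (fderiv ℝ (fderiv ℝ (ys z)) θstar)
    have h2 := Finset.sum_le_sum fun j (_ : j ∈ Finset.univ) =>
      norm_clm_le_sum (fderiv ℝ (fderiv ℝ (ys z)) θstar (EuclideanSpace.single j 1))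
    simp only [Real.norm_eq_abs] at h2
    linarith [hM1 z, abs_nonneg (L z)]
  have hVρ : ∀ j k, V j k = ∫ p : EuclideanSpace ℝ (Fin d) × ℝ,
      2 * (fderiv ℝ (ys p.1) θstar (EuclideanSpace.single k 1) *
        fderiv ℝ (ys p.1) θstar (EuclideanSpace.single j 1) - (ζ p.1 + p.2 - ys p.1 θstar) *
        fderiv ℝ (fderiv ℝ (ys p.1)) θstar (EuclideanSpace.single k 1)
          (EuclideanSpace.single j 1)) ∂(μ.prod ν) := fun j k => by
    set b : Fin q → EuclideanSpace ℝ (Fin q) := fun k => EuclideanSpace.single k 1 with hb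
    set w : EuclideanSpace ℝ (Fin d) → ℝ := fun z => 2 * (fderiv ℝ (ys z) θstar (b k) *
      fderiv ℝ (ys z) θstar (b j) - R z * fderiv ℝ (fderiv ℝ (ys z)) θstar (b k) (b j)) with hw
    set w' : EuclideanSpace ℝ (Fin d) → ℝ := fun z =>
      -2 * fderiv ℝ (fderiv ℝ (ys z)) θstar (b k) (b j) with hw'
    have h1 : Integrable (fun p : EuclideanSpace ℝ (Fin d) × ℝ => w p.1) (μ.prod ν) :=
      ((((hDv (b k)).integrable_mul (hDv (b j))).sub
        (hRμ.integrable_mul (hHv (b k) (b j)))).const_mul 2).comp_fst ν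
    have h2 : Integrable (fun p : EuclideanSpace ℝ (Fin d) × ℝ => w' p.1 * p.2) (μ.prod ν) :=
      (((hHv (b k) (b j)).integrable (by norm_num)).const_mul _).mul_prod
        (hνL.integrable (by norm_num))
    rw [hVμ, ← integral_fst_eq (ν := ν) w, ← add_zero (∫ p, w p.1 ∂(μ.prod ν)),
      ← integral_fst_mul_snd_eq_zero (μ := μ) hν0 w', ← integral_add h1 h2]
    refine integral_congr_ae (ae_of_all _ fun p => ?_)
    simp only [hw, hw', hR]
    ring
  have hexp' : IsLittleOpInvSqrt P (fun n ω => ‖(θhat n ω - θstar) - (-(V⁻¹.toEuclideanLin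
      ((1 / (n : ℝ)) • ∑ i ∈ Finset.range n, scoreFun R D (x i ω, e i ω))))‖ₑ) := by
    refine tendsto_expansion hZ (y := fun p => ζ p.1 + p.2) (F := fun p => ys p.1) hr
      (L := fun p => |L p.1|) (M := fun p => M p.1)
      (a := fun n ω i => yhat n ω (x i ω) (θhat n ω))
      (g := fun n ω i => fderiv ℝ (yhat n ω (x i ω)) (θhat n ω))
      (hΩρ.mono fun p hp => hC _ hp) (fun p => abs_nonneg _)
      (fun p => by linarith [hM1 p.1, hM2 p.1]) (fun p => hDM _) (fun p => hHM _)
      (hMμ.comp_fst ν) (hres θstar hθΘ) (fun v => (hDv v).comp_fst ν)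
      (fun v w => (hHv v w).comp_fst ν) hA4 hVρ (fun p j => ?_) hs hs0 hcons hδn hδ'n hδ' ?_ ?_ ?_
    · simp only [scoreFun, PiLp.smul_apply, smul_eq_mul, hDj, hR]
      ring
    · filter_upwards [hval, hLS] with p h1 h2 i using h1 i _ h2.1
    · filter_upwards [hder, hnear] with p h1 h2 i using h1 i _ h2
    · filter_upwards [hLS, hnear, hxΩp, hdiffp] with p h1 h2 h3 h4 j
      exact h1.empMean_eq_zero h2 (fun i => h4 _ (h3 i) _ h2) _
  have hexp : IsLittleOpInvSqrt P (fun n ω => ‖(θhat n ω - θstar) - (-(V⁻¹.toEuclideanLin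
      ((1 / (n : ℝ)) • ∑ i ∈ Finset.range n, score ζ ys x e θstar i ω)))‖ₑ) := by
    refine hexp'.congr ?_
    filter_upwards [hscore] with ω hω n
    simp only [hω]
  refine ⟨tendstoInMeasure_const_iff.2 hcons, hexp, ?_, fun T hT hTexp => ?_, hSB, hdiff, hiff,
    fun h => hiff.2 ?_, fun hne h => ?_⟩
  · have := hZ.hasAsymptoticCovariance_toEuclideanLin hs hs0 hS₂eq (-V⁻¹) hθhat_meas
      (by simpa only [map_neg, LinearMap.neg_apply] using hexp')
    simpa [hVinv] using this
  · have hT' : IsLittleOpInvSqrt P (fun n ω => ‖(T n ω - θstar) - V⁻¹.toEuclideanLin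
        ((1 / (n : ℝ)) • ∑ i ∈ Finset.range n, noiseFun D (x i ω, e i ω))‖ₑ) := by
      refine hTexp.congr (ae_of_all _ fun ω n => ?_)
      rw [← map_smul, smul_comm, Finset.smul_sum]
      simp only [noiseFun, smul_smul, hD]
    have := hZ.hasAsymptoticCovariance_toEuclideanLin (memLp_noiseFun hDμ hνL)
      (integral_noiseFun hν0) hS₁eq V⁻¹ hT hT'
    rwa [hVinv] at this
  · -- a perfect model has no bias term
    ext j k
    rw [hBeq]
    refine integral_eq_zero_of_ae ?_
    filter_upwards [(ae_cond_iff hvol_top).2 h] with z hz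
    simp [hR, hz]
  · -- the diagonal of `B = 0` forces `R D = 0` almost everywhere
    have hB0 : B = 0 := hiff.1 h
    have hzero : ∀ᵐ z ∂μ, ∀ j, R z * D z j = 0 := by
      refine ae_all_iff.2 fun j => ?_
      have h1 : ∫ z, (R z • D z) j * (R z • D z) j ∂μ = 0 := by rw [← hBeq, hB0]; rfl
      rw [integral_eq_zero_iff_of_nonneg (fun z => mul_self_nonneg _)
        ((memLp_coord hRD j).integrable_mul (memLp_coord hRD j))] at h1
      filter_upwards [h1] with z hz
      simpa using hz
    refine (ae_cond_iff hvol_top).1 ?_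
    filter_upwards [hzero, (ae_cond_iff hvol_top).2 hne] with z h1 h2
    by_contra h3
    have h4 : R z ≠ 0 := sub_ne_zero.2 h3
    refine h2 ?_
    ext j
    exact (mul_eq_zero.1 (h1 j)).resolve_left h4
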